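/- Let $A=(\boldsymbol a_1,\dots,\boldsymbol a_n)$ be a $d\times n$ integer matrix whose columns generate $\mathbb Z^d$ as an abelian group. Let $\mathbb N A\subseteq\mathbb Z^d$ be the monoid generated by the columns, $R_A=\mathbb C[\mathbb N A]$ its semigroup algebra, and $D(R_A)=\bigcup_{k\ge 0}D^k(R_A)\subseteq \mathrm{End}_{\mathbb C}(R_A)$ the ring of ($\mathbb C$-linear, Grothendieck) differential operators of $R_A$, where $D^0(R_A)=\mathrm{Hom}_{R_A}(R_A,R_A)$ and $D^{k+1}(R_A)=\{P\in\mathrm{End}_{\mathbb C}(R_A) : [f,P]\in D^k(R_A)\ \text{for all } f\in R_A\}$. For each facet (maximal proper face) $\sigma$ of the cone $\mathbb R_{\ge 0}A\subseteq\mathbb R^d$, let $F_\sigma$ be its primitive integral support function, that is, the unique linear form on $\mathbb R^d$ with $F_\sigma\ge 0$ on $\mathbb R_{\geq 0}A$, $F_\sigma=0$ on $\sigma$ and $F_\sigma(\mathbb Z^d)=\mathbb Z$. The semigroup $\mathbb N A$ is called scored if $$\mathbb N A=\bigcap_{\sigma}\{\boldsymbol a\in\mathbb Z^d : F_\sigma(\boldsymbol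 a)\in F_\sigma(\mathbb N A)\},$$ where $\sigma$ runs over all facets of $\mathbb R_{\ge 0}A$. Assume that the cone $\mathbb R_{\ge 0}A$ is simplicial, i.e. generated by finitely many linearly independent vectors. Then the ring $D(R_A)$ is simple (it has no two-sided ideals other than $0$ and itself) if and only if $\mathbb N A$ is scored. -/

import Mathlib

noncomputable section

namespace ToricDiffOp

section DifferentialOperators

variable (k R M : Type*) [CommRing k] [CommRing R] [Algebra k R]
  [AddCommGroup M] [Module k M] [Module R M] [IsScalarTower k R M]

/-- The commutator `[f, P] = f ∘ P - P ∘ f` of (multiplication by) `f : R` with a `k`-linear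
endomorphism `P` of the `R`-module `M`. -/
def opCommutator (f : R) (P : Module.End k M) : Module.End k M :=
  Algebra.lsmul k k M f * P - P * Algebra.lsmul k k M f

/-- `D^m(M)`: the `k`-linear differential operators of order at most `m` on the `R`-module `M`
(Grothendieck). `D^0(M) = Hom_R(M, M)`, and `P ∈ D^{m+1}(M)` iff `[f, P] ∈ D^m(M)` for
all `f : R`. -/
def diffOpOrder : ℕ → Submodule k (Module.End k M)
  | 0 =>
    { carrier := {P | ∀ (f : R) (x : M), P (f • x) = f • P x}
      zero_mem' := by intro f x; simp
      add_mem' := by intro P Q hP hQ f x; simp [hP f x, hQ f x]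
      smul_mem' := by intro c P hP f x; simp [hP f x, smul_algebra_smul_comm] }
  | m + 1 =>
    { carrier := {P | ∀ f : R, opCommutator k R M f P ∈ diffOpOrder m}
      zero_mem' := by intro f; simp [opCommutator]
      add_mem' := by
        intro P Q hP hQ f
        have h : opCommutator k R M f (P + Q) = opCommutator k R M f P + opCommutator k R M f Q := by
          simp only [opCommutator, mul_add, add_mul]; abel
        rw [h]
        exact add_mem (hP f) (hQ f)
      smul_mem' := by
        intro c P hP f
        have h : opCommutator k R M f (c • P) = c • opCommutator k R M f P := by
          simp only [opCommutator, mul_smul_comm, smul_mul_assoc, smul_sub]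
        rw [h]
        exact Submodule.smul_mem _ c (hP f) }

theorem opCommutator_eq_zero {P : Module.End k M} (hP : P ∈ diffOpOrder k R M 0) (f : R) :
    opCommutator k R M f P = 0 := by
  ext x
  have h : P (f • x) = f • P x := hP f x
  simp [opCommutator, h]

theorem diffOpOrder_le_succ (m : ℕ) : diffOpOrder k R M m ≤ diffOpOrder k R M (m + 1) := by
  induction m with
  | zero =>
    intro P hP f
    rw [opCommutator_eq_zero k R M hP f]
    exact zero_mem _
  | succ m ih => exact fun P hP f => ih (hP f)

theorem diffOpOrder_mono {m n : ℕ} (h : m ≤ n) : diffOpOrder k R M m ≤ diffOpOrder k R M n :=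
  monotone_nat_of_le_succ (diffOpOrder_le_succ k R M) h

theorem opCommutator_mul (f : R) (P Q : Module.End k M) :
    opCommutator k R M f (P * Q) = opCommutator k R M f P * Q + P * opCommutator k R M f Q := by
  simp only [opCommutator]; noncomm_ring

theorem diffOpOrder_mul (s : ℕ) : ∀ (m n : ℕ), m + n = s → ∀ P ∈ diffOpOrder k R M m,
    ∀ Q ∈ diffOpOrder k R M n, P * Q ∈ diffOpOrder k R M (m + n) := by
  induction s with
  | zero =>
    intro m n hs P hP Q hQ
    obtain ⟨rfl, rfl⟩ : m = 0 ∧ n = 0 := by omega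
    intro f x
    have h1 : Q (f • x) = f • Q x := hQ f x
    have h2 : P (f • Q x) = f • P (Q x) := hP f (Q x)
    simp [h1, h2]
  | succ s ih =>
    intro m n hs P hP Q hQ
    rw [hs]
    intro f
    rw [opCommutator_mul]
    refine add_mem ?_ ?_
    · cases m with
      | zero =>
        rw [opCommutator_eq_zero k R M hP f, zero_mul]
        exact zero_mem _
      | succ m =>
        have h := ih m n (by omega) _ (hP f) Q hQ
        rwa [show m + n = s by omega] at h
    · cases n with
      | zero =>
        rw [opCommutator_eq_zero k R M hQ f, mul_zero]
        exact zero_mem _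
      | succ n =>
        have h := ih m n (by omega) P hP _ (hQ f)
        rwa [show m + n = s by omega] at h

/-- `D(M) = ⋃ₘ D^m(M)`: the `k`-algebra of differential operators on the `R`-module `M`, with
composition as multiplication. -/
def diffOp : Subalgebra k (Module.End k M) where
  carrier := {P | ∃ m : ℕ, P ∈ diffOpOrder k R M m}
  mul_mem' := by
    rintro P Q ⟨m, hP⟩ ⟨n, hQ⟩
    exact ⟨m + n, diffOpOrder_mul k R M _ m n rfl P hP Q hQ⟩
  add_mem' := by
    rintro P Q ⟨m, hP⟩ ⟨n, hQ⟩
    exact ⟨m + n, add_mem (diffOpOrder_mono k R M (Nat.le_add_right m n) hP)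
      (diffOpOrder_mono k R M (Nat.le_add_left n m) hQ)⟩
  algebraMap_mem' := by
    intro c
    refine ⟨0, fun f x => ?_⟩
    simp [Module.algebraMap_end_apply, smul_algebra_smul_comm]

end DifferentialOperators

section Semigroup

variable {d n : ℕ}

/-- `ℕA`: the submonoid of `ℤ^d` generated by the columns of `A`. -/
def natSpan (A : Matrix (Fin d) (Fin n) ℤ) : AddSubmonoid (Fin d → ℤ) :=
  AddSubmonoid.closure (Set.range A.col)

/-- `ℤA`: the subgroup of `ℤ^d` generated by the columns of `A`. -/
def intSpan (A : Matrix (Fin d) (Fin n) ℤ) : AddSubgroup (Fin d → ℤ) :=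
  AddSubgroup.closure (Set.range A.col)

/-- The semigroup algebra `R_A = ℂ[ℕA]`. -/
abbrev semigroupRing (A : Matrix (Fin d) (Fin n) ℤ) : Type :=
  AddMonoidAlgebra ℂ (natSpan A)

/-- `D(R_A)`: the ring of `ℂ`-linear differential operators of the commutative ring `R_A`. -/
abbrev ringDiffOp (A : Matrix (Fin d) (Fin n) ℤ) :
    Subalgebra ℂ (Module.End ℂ (semigroupRing A)) :=
  diffOp ℂ (semigroupRing A) (semigroupRing A)

/-- The inclusion `ℤ^d ⊆ ℝ^d`. -/
def toReal (a : Fin d → ℤ) : Fin d → ℝ := fun i => (a i : ℝ)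

/-- The cone `ℝ_{≥0}A ⊆ ℝ^d` generated by the columns of `A`. -/
def cone (A : Matrix (Fin d) (Fin n) ℤ) : PointedCone ℝ (Fin d → ℝ) :=
  PointedCone.hull ℝ (Set.range fun j => toReal (A.col j))

/-- A facet of a cone is a maximal proper face. -/
def IsFacet (σ C : PointedCone ℝ (Fin d → ℝ)) : Prop :=
  Maximal (fun τ : PointedCone ℝ (Fin d → ℝ) => τ.IsFaceOf C ∧ τ ≠ C) σ

/-- `F` is the primitive integral support function of the facet `σ` of the cone `C`: a linear form
on `ℝ^d` with `F(C) ≥ 0`, `F(σ) = 0` and `F(ℤ^d) = ℤ`. -/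
structure IsPrimitiveSupport (C σ : PointedCone ℝ (Fin d → ℝ))
    (F : (Fin d → ℝ) →ₗ[ℝ] ℝ) : Prop where
  nonneg : ∀ x ∈ C, 0 ≤ F x
  eq_zero : ∀ x ∈ σ, F x = 0
  primitive : Set.range (fun a : Fin d → ℤ => F (toReal a)) = Set.range ((↑) : ℤ → ℝ)

/-- `ℕA` is scored: it equals the intersection, over all facets `σ` of `ℝ_{≥0}A`, of the sets
`{a ∈ ℤ^d : F_σ(a) ∈ F_σ(ℕA)}`, where `F_σ` is the primitive integral support function
of `σ`. -/
def IsScored (A : Matrix (Fin d) (Fin n) ℤ) : Prop :=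
  (natSpan A : Set (Fin d → ℤ)) =
    {a | ∀ (σ : PointedCone ℝ (Fin d → ℝ)) (F : (Fin d → ℝ) →ₗ[ℝ] ℝ),
      IsFacet σ (cone A) → IsPrimitiveSupport (cone A) σ F →
        F (toReal a) ∈ (fun b => F (toReal b)) '' (natSpan A : Set (Fin d → ℤ))}

end Semigroup

end ToricDiffOp

end

/-! Write `S = ℕA` and let `F_i` be the facet forms. As the cone is simplicial, the `F_i` are
coordinates on `ℝ^d`, and `S` has a point on each ray. An operator `P ∈ D(ℂ[S])` splits into
finitely many homogeneous parts `t^b ↦ p(b) t^{a+b}`. Bracketing with `t^c` takes a finite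
difference of the coefficient function, so finite order makes `p` a polynomial in the `F_i(b)`
(`component_mem_vanishingDiff`, `exists_mvPolynomial`). Conversely, a polynomial `p` defines an
operator of degree `a` once it vanishes at every `b ∈ S` with `a + b ∉ S` (`monomialOp_mem`).

Scored implies simple. For scored `S`, leaving `S` under translation by `a` forces some `F_i(b)`
into a finite set, so every `a ∈ ℤ^d` is the degree of a nonzero operator, with coefficient
`exitPoly a`. A nonzero ideal contains a multiplication operator (by commutators), then a monomial
(by Euler operators), then a nonzero polynomial `p` in degree `0`. Passing to degree `a` and back
puts the translate of `p` by `a`, times exit factors, in the ideal. At a common zero `z` of the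
degree-zero part, enough `a` have exit factors nonzero at `z` that `p` vanishes on a Zariski dense
set, which is absurd; the Nullstellensatz yields `1` (`polyIdeal_eq_top`).

Simple implies scored. Every operator extends to `ℂ[ℤ^d]`, and the extension preserves the span of
the scored closure of `S` (`IsExtension.map_closureSpan`). Hence the operators whose extension maps
this span into `ℂ[S]` form a two-sided ideal. It contains multiplication by a conductor monomial, so
simplicity puts `1` in it, and the closure lies in `S` (`scored_of_isSimpleRing`). -/

noncomputable section

namespace ToricDiffOp

open AddMonoidAlgebra

/-! ### Functions killed by iterated finite differences. -/

section FiniteDifferences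

variable {M : Type*} [AddCommMonoid M]

/-- The functions on `M` all of whose `k`-fold iterated differences vanish. -/
def vanishingDiff (M : Type*) [AddCommMonoid M] : ℕ → Submodule ℂ (M → ℂ)
  | 0 => ⊥
  | k + 1 =>
    { carrier := {f | ∀ c, fwdDiff c f ∈ vanishingDiff M k}
      zero_mem' := by
        intro c
        rw [show fwdDiff c (0 : M → ℂ) = 0 by ext; simp [fwdDiff]]
        exact zero_mem _
      add_mem' := by
        intro f g hf hg c
        rw [fwdDiff_add]
        exact add_mem (hf c) (hg c)
      smul_mem' := by
        intro r f hf c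
        rw [fwdDiff_const_smul]
        exact Submodule.smul_mem _ r (hf c) }

theorem vanishingDiff_le_succ (k : ℕ) : vanishingDiff M k ≤ vanishingDiff M (k + 1) := by
  induction k with
  | zero =>
    intro f hf c
    rw [(Submodule.mem_bot ℂ).1 hf, show fwdDiff c (0 : M → ℂ) = 0 by ext; simp [fwdDiff]]
    exact zero_mem _
  | succ k ih => exact fun f hf c => ih (hf c)

theorem vanishingDiff_mono {k l : ℕ} (h : k ≤ l) : vanishingDiff M k ≤ vanishingDiff M l :=
  monotone_nat_of_le_succ vanishingDiff_le_succ h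

theorem shift_mem_vanishingDiff {k : ℕ} {f : M → ℂ} (hf : f ∈ vanishingDiff M k) (c : M) :
    (fun x => f (x + c)) ∈ vanishingDiff M k := by
  have h := add_mem (vanishingDiff_le_succ k hf c) hf
  rwa [show fwdDiff c f + f = fun x => f (x + c) by ext; simp [fwdDiff]] at h

theorem iterate_fwdDiff_mem {k : ℕ} {f : M → ℂ} (hf : f ∈ vanishingDiff M k) (c : M) (j : ℕ) :
    (fwdDiff c)^[j] f ∈ vanishingDiff M k := by
  induction j with
  | zero => exact hf
  | succ j ih =>
    rw [Function.iterate_succ_apply']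
    exact vanishingDiff_le_succ k ih c

theorem iterate_fwdDiff_eq_zero {k : ℕ} {f : M → ℂ} (hf : f ∈ vanishingDiff M k) (c : M) :
    (fwdDiff c)^[k] f = 0 := by
  induction k generalizing f with
  | zero => exact (Submodule.mem_bot ℂ).1 hf
  | succ k ih => exact ih (hf c)

theorem const_mem_vanishingDiff (r : ℂ) : (fun _ => r : M → ℂ) ∈ vanishingDiff M 1 := by
  intro c
  rw [fwdDiff_const]
  exact zero_mem _

/-- Discrete Leibniz rule: `Δ_c(f x) = (Δ_c f) x + x(c) f(· + c)`. -/
theorem mul_addHom_mem_vanishingDiff (x : M →+ ℂ) {k : ℕ} {f : M → ℂ}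
    (hf : f ∈ vanishingDiff M k) : f * x ∈ vanishingDiff M (k + 1) := by
  induction k generalizing f with
  | zero =>
    rw [(Submodule.mem_bot ℂ).1 hf, zero_mul]
    exact zero_mem _
  | succ k ih =>
    intro c
    have h := add_mem (ih (hf c)) (Submodule.smul_mem _ (x c) (shift_mem_vanishingDiff hf c))
    convert h using 1
    ext b
    simp [fwdDiff]
    ring

end FiniteDifferences

/-! ### Homogeneous components of differential operators. -/

variable {G : Type*} [AddCommGroup G] (S : AddSubmonoid G)

/-- The inclusion `ℂ[S] ⊆ ℂ[G]`. -/
def incl : AddMonoidAlgebra ℂ S →ₐ[ℂ] AddMonoidAlgebra ℂ G :=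
  AddMonoidAlgebra.mapDomainAlgHom ℂ ℂ S.subtype

variable {S}

@[simp]
theorem incl_single (b : S) (r : ℂ) : incl S (single b r) = single (b : G) r := by
  simp [incl]

theorem incl_coeff_of_notMem (x : AddMonoidAlgebra ℂ S) {z : G} (hz : z ∉ S) :
    (incl S x).coeff z = 0 := by
  change (Finsupp.mapDomain Subtype.val x.coeff) z = 0
  refine Finsupp.mapDomain_of_notMem_range _ _ ?_
  simpa using hz

theorem coeff_single_mul_add (c z : G) (r : ℂ) (x : AddMonoidAlgebra ℂ G) :
    (single c r * x).coeff (c + z) = r * x.coeff z :=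
  x.coeff_single_mul_eq_mul_coeff z (by simp)

/-- The function `b ↦ [t^{a+b}] P(t^b)` describing the part of degree `a` of `P`. -/
def component (P : Module.End ℂ (AddMonoidAlgebra ℂ S)) (a : G) : S → ℂ :=
  fun b => (incl S (P (single b 1))).coeff (a + b)

theorem component_zero (a : G) :
    component (0 : Module.End ℂ (AddMonoidAlgebra ℂ S)) a = 0 := by
  ext
  simp [component]

/-- The dictionary between order and differences: each bracket with a monomial costs one difference
and shifts the degree. -/
theorem component_opCommutator (P : Module.End ℂ (AddMonoidAlgebra ℂ S)) (a : G) (c : S) :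
    component (opCommutator ℂ (AddMonoidAlgebra ℂ S) _ (single c 1) P) (a + c) =
      -fwdDiff c (component P a) := by
  ext b
  have h1 : opCommutator ℂ (AddMonoidAlgebra ℂ S) _ (single c 1) P (single b 1) =
      single c 1 * P (single b 1) - P (single (b + c) 1) := by
    simp [opCommutator, single_mul_single, add_comm]
  have h2 : a + (c : G) + b = c + (a + b) := by abel
  have h3 : c + (a + (b : G)) = a + ((b + c : S) : G) := by push_cast; abel
  rw [component, h1, map_sub, map_mul, incl_single, h2, AddMonoidAlgebra.coeff_sub, Finsupp.sub_apply,
    coeff_single_mul_add, h3]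
  simp [fwdDiff, component]

theorem component_mem_vanishingDiff {k : ℕ} {P : Module.End ℂ (AddMonoidAlgebra ℂ S)}
    (hP : P ∈ diffOpOrder ℂ (AddMonoidAlgebra ℂ S) _ k) (a : G) :
    component P a ∈ vanishingDiff S (k + 1) := by
  induction k generalizing P a with
  | zero =>
    intro c
    have h := component_opCommutator P a c
    rw [opCommutator_eq_zero _ _ _ hP] at h
    rw [← neg_neg (fwdDiff c _), ← h, component_zero, neg_zero]
    exact zero_mem _
  | succ k ih =>
    intro c
    have h := ih (hP (single c 1)) (a + c)
    rw [component_opCommutator] at h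
    exact neg_mem_iff.1 h

theorem component_eq_const (P : Module.End ℂ (AddMonoidAlgebra ℂ S)) (a : G) (T : Set S)
    (hT : AddSubmonoid.closure T = ⊤)
    (h : ∀ c ∈ T, component (opCommutator ℂ (AddMonoidAlgebra ℂ S) _ (single c 1) P) (a + c) = 0)
    (b : S) : component P a b = component P a 0 := by
  have hb : b ∈ AddSubmonoid.closure T := hT ▸ AddSubmonoid.mem_top b
  induction hb using AddSubmonoid.closure_induction_right with
  | zero => rfl
  | add_right x _ c hc ih =>
    have h1 := h c hc
    rw [component_opCommutator, neg_eq_zero] at h1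
    rw [← ih]
    exact sub_eq_zero.1 (congrFun h1 x)

/-- Outside finitely many degrees `a`, the brackets with the generators vanish in degree `a + c`, so
the component is constant; its value is the coefficient of `t^a` in `P(1)`, which is nonzero for
finitely many `a` only. -/
theorem finite_component_ne_zero_of_opCommutator (P : Module.End ℂ (AddMonoidAlgebra ℂ S))
    (T : Set S) (hT : AddSubmonoid.closure T = ⊤) (hfin : T.Finite)
    (h : ∀ c ∈ T, {a | component (opCommutator ℂ (AddMonoidAlgebra ℂ S) _ (single c 1) P) a ≠
      0}.Finite) :
    {a | component P a ≠ 0}.Finite := by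
  have h1 : (⋃ c ∈ T, (fun a => a - (c : G)) '' {a | component (opCommutator ℂ
      (AddMonoidAlgebra ℂ S) _ (single c 1) P) a ≠ 0}).Finite :=
    hfin.biUnion fun c hc => (h c hc).image _
  refine (h1.union (incl S (P (single 0 1))).coeff.support.finite_toSet).subset ?_
  intro a ha
  by_contra hcon
  simp only [Set.mem_union, not_or, Set.mem_iUnion, not_exists, Set.mem_image] at hcon
  refine ha (funext fun b => ?_)
  rw [component_eq_const P a T hT ?_ b]
  · simpa [component] using hcon.2
  · intro c hc
    by_contra hne
    exact hcon.1 c hc (a + c) ⟨hne, by simp⟩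

theorem finite_component_ne_zero (T : Set S) (hT : AddSubmonoid.closure T = ⊤) (hfin : T.Finite)
    {k : ℕ} {P : Module.End ℂ (AddMonoidAlgebra ℂ S)}
    (hP : P ∈ diffOpOrder ℂ (AddMonoidAlgebra ℂ S) _ k) : {a | component P a ≠ 0}.Finite := by
  induction k generalizing P with
  | zero =>
    refine finite_component_ne_zero_of_opCommutator P T hT hfin fun c _ => ?_
    rw [opCommutator_eq_zero _ _ _ hP]
    simp [component_zero]
  | succ k ih =>
    exact finite_component_ne_zero_of_opCommutator P T hT hfin fun c _ => ih (hP _)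

/-! ### Constructing homogeneous operators. -/

section MonomialOp

variable (S)

open Classical in
/-- The operator `t^b ↦ φ(b) t^{a+b}` on `ℂ[S]`, with `t^{a+b}` read as `0` if `a + b ∉ S`. -/
def monomialOp (a : G) (φ : G → ℂ) : Module.End ℂ (AddMonoidAlgebra ℂ S) :=
  (AddMonoidAlgebra.basis S ℂ).constr ℂ fun b =>
    if h : a + b ∈ S then single ⟨a + b, h⟩ (φ b) else 0

variable {S}

theorem end_ext {N : Type*} [AddCommMonoid N] [Module ℂ N] {M : Type*}
    {P Q : AddMonoidAlgebra ℂ M →ₗ[ℂ] N} (h : ∀ b, P (single b 1) = Q (single b 1)) : P = Q :=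
  (AddMonoidAlgebra.basis M ℂ).ext h

theorem monomialOp_of_mem {a : G} (φ : G → ℂ) {b : S} (h : a + b ∈ S) :
    monomialOp S a φ (single b 1) = single ⟨a + b, h⟩ (φ b) := by
  have := (AddMonoidAlgebra.basis S ℂ).constr_basis ℂ (fun b : S =>
    open Classical in if h : a + b ∈ S then single (⟨a + b, h⟩ : S) (φ b) else 0) b
  rw [AddMonoidAlgebra.basis_apply] at this
  rw [monomialOp, this, dif_pos h]

theorem monomialOp_of_notMem {a : G} (φ : G → ℂ) {b : S} (h : a + b ∉ S) :
    monomialOp S a φ (single b 1) = 0 := by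
  have := (AddMonoidAlgebra.basis S ℂ).constr_basis ℂ (fun b : S =>
    open Classical in if h : a + b ∈ S then single (⟨a + b, h⟩ : S) (φ b) else 0) b
  rw [AddMonoidAlgebra.basis_apply] at this
  rw [monomialOp, this, dif_neg h]

theorem single_eq_smul {M : Type*} (b : M) (r : ℂ) :
    (single b r : AddMonoidAlgebra ℂ M) = r • single b 1 := by
  simp [AddMonoidAlgebra.smul_single]

theorem monomialOp_single_of_mem {a : G} (φ : G → ℂ) {b : S} (r : ℂ) (h : a + b ∈ S) :
    monomialOp S a φ (single b r) = single ⟨a + b, h⟩ (r * φ b) := by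
  rw [single_eq_smul, map_smul, monomialOp_of_mem φ h, AddMonoidAlgebra.smul_single, smul_eq_mul]

/-- `φ` vanishes at those `b ∈ S` for which `a + b ∉ S`. -/
def VanishesOnExit (S : AddSubmonoid G) (a : G) (φ : G → ℂ) : Prop :=
  ∀ b ∈ S, a + b ∉ S → φ b = 0

/-- The exit condition covers the case where `b + c` leaves `S` but `a + b + c` is back in `S`: the
composite is then `0`, and so is `ψ c`. -/
theorem monomialOp_mul (a b : G) (φ ψ : G → ℂ) (hψ : VanishesOnExit S b ψ) :
    monomialOp S a φ * monomialOp S b ψ = monomialOp S (a + b) (fun c => φ (b + c) * ψ c) := by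
  refine end_ext fun c => ?_
  rw [Module.End.mul_apply]
  by_cases hb : b + c ∈ S
  · rw [monomialOp_of_mem ψ hb]
    by_cases ha : a + (b + c) ∈ S
    · rw [monomialOp_single_of_mem φ _ (b := ⟨b + c, hb⟩) ha,
        monomialOp_of_mem (a := a + b) _ (by rwa [add_assoc])]
      simp [add_assoc, mul_comm]
    · rw [single_eq_smul, map_smul, monomialOp_of_notMem φ (b := ⟨b + c, hb⟩) ha, smul_zero,
        monomialOp_of_notMem (a := a + b) _ (by rwa [add_assoc])]
  · rw [monomialOp_of_notMem ψ hb, map_zero]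
    by_cases ha : a + b + c ∈ S
    · rw [monomialOp_of_mem _ ha, hψ c c.2 hb]
      simp
    · rw [monomialOp_of_notMem _ ha]

theorem lsmul_single (c : S) :
    Algebra.lsmul ℂ ℂ (AddMonoidAlgebra ℂ S) (single c 1 : AddMonoidAlgebra ℂ S) =
      monomialOp S c 1 := by
  refine end_ext fun b => ?_
  rw [monomialOp_of_mem _ (S.add_mem c.2 b.2)]
  simp [single_mul_single]
  rfl

theorem opCommutator_monomialOp (a : G) (φ : G → ℂ) (hφ : VanishesOnExit S a φ) (c : S) :
    opCommutator ℂ (AddMonoidAlgebra ℂ S) _ (single c 1) (monomialOp S a φ) =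
      monomialOp S (a + c) (-fwdDiff (c : G) φ) := by
  have hc : VanishesOnExit S (c : G) 1 := fun b hb h => (h (S.add_mem c.2 hb)).elim
  rw [opCommutator, lsmul_single, monomialOp_mul _ _ _ _ hφ, monomialOp_mul _ _ _ _ hc,
    add_comm (c : G) a]
  refine end_ext fun b => ?_
  rw [LinearMap.sub_apply]
  by_cases h : a + c + b ∈ S
  · rw [monomialOp_of_mem _ h, monomialOp_of_mem _ h, monomialOp_of_mem _ h]
    ext z
    by_cases hz : (⟨a + c + b, h⟩ : S) = z
    · simp [fwdDiff, add_comm]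
    · simp [hz]
  · rw [monomialOp_of_notMem _ h, monomialOp_of_notMem _ h, monomialOp_of_notMem _ h, sub_zero]

theorem VanishesOnExit.fwdDiff {a : G} {φ : G → ℂ} (hφ : VanishesOnExit S a φ) (c : S) :
    VanishesOnExit S (a + c) (-fwdDiff (c : G) φ) := by
  intro b hb h
  have h1 : φ b = 0 := hφ b hb fun h' => h (by
    have := S.add_mem h' c.2
    rwa [show a + b + (c : G) = a + c + b by abel] at this)
  have h2 : φ (b + c) = 0 := hφ _ (S.add_mem hb c.2) fun h' => h (by
    rwa [show a + (b + (c : G)) = a + c + b by abel] at h')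
  simp [_root_.fwdDiff, h1, h2]

theorem opCommutator_mem_of_single (p : Submodule ℂ (Module.End ℂ (AddMonoidAlgebra ℂ S)))
    (P : Module.End ℂ (AddMonoidAlgebra ℂ S))
    (h : ∀ c : S, opCommutator ℂ (AddMonoidAlgebra ℂ S) _ (single c 1) P ∈ p)
    (f : AddMonoidAlgebra ℂ S) : opCommutator ℂ (AddMonoidAlgebra ℂ S) _ f P ∈ p := by
  induction f using AddMonoidAlgebra.induction_linear with
  | zero =>
    convert zero_mem p
    simp [opCommutator]
  | add f g hf hg =>
    convert add_mem hf hg using 1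
    simp only [opCommutator, map_add, add_mul, mul_add]
    abel
  | single c r =>
    convert p.smul_mem r (h c) using 1
    rw [single_eq_smul, opCommutator, opCommutator, map_smul, smul_sub, smul_mul_assoc,
      mul_smul_comm]

theorem mem_diffOpOrder_zero_of_opCommutator {P : Module.End ℂ (AddMonoidAlgebra ℂ S)}
    (h : ∀ f, opCommutator ℂ (AddMonoidAlgebra ℂ S) _ f P = 0) :
    P ∈ diffOpOrder ℂ (AddMonoidAlgebra ℂ S) (AddMonoidAlgebra ℂ S) 0 := by
  intro f x
  have h1 : f • P x - P (f • x) = 0 := LinearMap.congr_fun (h f) x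
  exact (sub_eq_zero.1 h1).symm

theorem monomialOp_mem_diffOpOrder {k : ℕ} {a : G} {φ : G → ℂ} (hφ : VanishesOnExit S a φ)
    (h : φ ∈ vanishingDiff G (k + 1)) :
    monomialOp S a φ ∈ diffOpOrder ℂ (AddMonoidAlgebra ℂ S) (AddMonoidAlgebra ℂ S) k := by
  induction k generalizing a φ with
  | zero =>
    refine mem_diffOpOrder_zero_of_opCommutator fun f => ?_
    refine (Submodule.mem_bot ℂ).1 (opCommutator_mem_of_single ⊥ _ (fun c => ?_) f)
    rw [opCommutator_monomialOp a φ hφ, Submodule.mem_bot, (Submodule.mem_bot ℂ).1 (h (c : G))]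
    refine end_ext fun b => ?_
    by_cases hb : a + c + b ∈ S
    · rw [monomialOp_of_mem _ hb]
      simp
    · rw [monomialOp_of_notMem _ hb, LinearMap.zero_apply]
  | succ k ih =>
    refine fun f => opCommutator_mem_of_single _ _ (fun c => ?_) f
    rw [opCommutator_monomialOp a φ hφ]
    exact ih (hφ.fwdDiff c) (neg_mem (h c))

end MonomialOp

/-! ### Newton interpolation: vanishing differences give polynomials. -/

section Newton

variable {M : Type*} [AddCommMonoid M]

/-- Newton's forward formula; the differences of order at least `k` vanish, so the number of terms
does not depend on `n`. -/
theorem shift_eq_sum_range {k : ℕ} {f : M → ℂ} (hf : f ∈ vanishingDiff M k) (c y : M) (n : ℕ) :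
    f (y + n • c) = ∑ j ∈ Finset.range k, (n.choose j : ℂ) * (fwdDiff c)^[j] f y := by
  rw [shift_eq_sum_fwdDiff_iter c f n y]
  simp only [nsmul_eq_mul]
  have h1 : Finset.range (n + 1) ⊆ Finset.range (n + 1 + k) := by simp
  have h2 : Finset.range k ⊆ Finset.range (n + 1 + k) := by simp
  rw [Finset.sum_subset h1, Finset.sum_subset h2]
  · intro j _ hj
    obtain ⟨i, rfl⟩ := Nat.exists_eq_add_of_le (not_lt.1 fun h => hj (Finset.mem_range.2 h))
    rw [Nat.add_comm, Function.iterate_add_apply, iterate_fwdDiff_eq_zero hf]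
    have h0 : (fwdDiff c)^[i] (0 : M → ℂ) = 0 := by
      have h3 := iterate_fwdDiff_mem (zero_mem (vanishingDiff M 0)) c i
      exact (Submodule.mem_bot ℂ).1 h3
    simp [h0]
  · intro j _ hj
    rw [Nat.choose_eq_zero_of_lt (by simpa [Nat.lt_succ_iff] using hj)]
    simp

/-- Newton's formula is applied in one direction at a time: `N.choose j` is polynomial in `N`, and
the iterated differences are polynomial in the remaining variables by induction. -/
theorem exists_mvPolynomial_of_vanishingDiff {ι : Type*} (w : ι → M) (y : M) (T : Finset ι) :
    ∀ {k : ℕ} {f : M → ℂ}, f ∈ vanishingDiff M k → ∃ p : MvPolynomial ι ℂ, ∀ N : ι → ℕ,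
      f (y + ∑ i ∈ T, N i • w i) = MvPolynomial.eval (fun i => (N i : ℂ)) p := by
  classical
  induction T using Finset.induction_on with
  | empty =>
    intro k f _
    exact ⟨MvPolynomial.C (f y), fun N => by simp⟩
  | insert i T hi ih =>
    intro k f hf
    choose p hp using fun j => ih (iterate_fwdDiff_mem hf (w i) j)
    refine ⟨∑ j ∈ Finset.range k, MvPolynomial.C ((j.factorial : ℂ)⁻¹) *
      Polynomial.aeval (MvPolynomial.X i) (descPochhammer ℂ j) * p j, fun N => ?_⟩
    rw [Finset.sum_insert hi, add_comm (N i • w i), ← add_assoc, shift_eq_sum_range hf, map_sum]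
    refine Finset.sum_congr rfl fun j _ => ?_
    rw [hp, map_mul, map_mul, MvPolynomial.eval_C]
    congr 1
    have h1 : MvPolynomial.eval (fun i => (N i : ℂ))
        (Polynomial.aeval (MvPolynomial.X i) (descPochhammer ℂ j)) =
        (descPochhammer ℂ j).eval (N i : ℂ) := by
      rw [← MvPolynomial.coe_aeval_eq_eval, RingHom.coe_coe, ← Polynomial.aeval_algHom_apply,
        MvPolynomial.aeval_X, Polynomial.coe_aeval_eq_eval]
    rw [h1, Nat.cast_choose_eq_descPochhammer_div]
    ring

end Newton

theorem eval_aeval_mvPolynomial {σ τ : Type*} (s : σ → MvPolynomial τ ℂ) (z : τ → ℂ)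
    (p : MvPolynomial σ ℂ) : MvPolynomial.eval z (MvPolynomial.aeval s p) =
      MvPolynomial.eval (fun j => MvPolynomial.eval z (s j)) p := by
  rw [MvPolynomial.aeval_eq_bind₁, MvPolynomial.eval, MvPolynomial.eval₂Hom_bind₁]
  rfl

/-! ### Zariski density of grids. -/

section Density

variable {d : ℕ}

theorem eq_zero_of_eval_translates {p : MvPolynomial (Fin d) ℂ} (x c : Fin d → ℂ)
    (hc : ∀ i, c i ≠ 0) (n : ℕ)
    (h : ∀ N : Fin d → ℕ, (∀ i, n ≤ N i) → MvPolynomial.eval (fun i => x i + N i * c i) p = 0) :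
    p = 0 := by
  refine MvPolynomial.funext_set (fun i => (fun m : ℕ => x i + m * c i) '' Set.Ici n) ?_ ?_
  · intro i
    refine (Set.Ici_infinite n).image fun a _ b _ hab => ?_
    have := mul_right_cancel₀ (hc i) (add_left_cancel hab)
    exact_mod_cast this
  · intro y hy
    choose N hN hNy using fun i => hy i (Set.mem_univ i)
    rw [map_zero, ← h N hN]
    congr 2
    ext i
    exact (hNy i).symm

/-- Freezing the `i`-th variable at `x i` reduces this to density of a full grid. -/
theorem eval_eq_zero_of_eval_translates_hyperplane {p : MvPolynomial (Fin d) ℂ} (x c : Fin d → ℂ)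
    (hc : ∀ i, c i ≠ 0) (i : Fin d)
    (h : ∀ N : Fin d → ℕ, N i = 0 → MvPolynomial.eval (fun j => x j + N j * c j) p = 0)
    {y : Fin d → ℂ} (hy : y i = x i) : MvPolynomial.eval y p = 0 := by
  let s : Fin d → MvPolynomial (Fin d) ℂ :=
    fun j => if j = i then MvPolynomial.C (x i) else MvPolynomial.X j
  have hs : ∀ z, MvPolynomial.eval z (MvPolynomial.aeval s p) =
      MvPolynomial.eval (Function.update z i (x i)) p := by
    intro z
    rw [eval_aeval_mvPolynomial]
    congr 2
    ext j
    by_cases hj : j = i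
    · subst hj
      simp [s]
    · simp [s, hj]
  have h0 : MvPolynomial.aeval s p = 0 := by
    refine eq_zero_of_eval_translates x c hc 0 fun N _ => ?_
    rw [hs, ← h (Function.update N i 0) (by simp)]
    congr 2
    ext j
    by_cases hj : j = i
    · subst hj
      simp
    · simp [hj]
  have h1 := hs y
  rw [h0, map_zero, ← hy, Function.update_eq_self] at h1
  exact h1.symm

end Density

/-! ### Coordinates on a simplicial semigroup. -/

/-- Integral linear forms on `G` cutting out the simplicial cone over `S`, together with
elements of `S` spanning its rays. -/
structure SimplicialForms {G : Type*} [AddCommGroup G] (S : AddSubmonoid G) (d : ℕ) where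
  form : Fin d → G →+ ℤ
  ray : Fin d → G
  ray_mem : ∀ i, ray i ∈ S
  form_ray_of_ne : ∀ i j, i ≠ j → form i (ray j) = 0
  form_ray_pos : ∀ i, 0 < form i (ray i)
  nonneg : ∀ i, ∀ x ∈ S, 0 ≤ form i x
  exists_form_eq_one : ∀ i, ∃ x, form i x = 1
  eq_zero_of_form : ∀ x, (∀ i, form i x = 0) → x = 0
  exists_sub : ∀ x, ∃ s ∈ S, ∃ t ∈ S, x = s - t

namespace SimplicialForms

variable {G : Type*} [AddCommGroup G] {S : AddSubmonoid G} {d : ℕ} (D : SimplicialForms S d)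

/-- The values of the forms at a lattice point, as a point of `ℂ^d`. -/
def ev (b : G) : Fin d → ℂ := fun i => (D.form i b : ℂ)

theorem ev_add (a b : G) : D.ev (a + b) = D.ev a + D.ev b := by
  ext i
  simp [ev]

theorem form_sum_zsmul_ray (N : Fin d → ℤ) (i : Fin d) :
    D.form i (∑ j, N j • D.ray j) = N i * D.form i (D.ray i) := by
  rw [map_sum, Finset.sum_eq_single i]
  · simp
  · intro j _ hj
    simp [D.form_ray_of_ne i j hj.symm]
  · simp

theorem form_sum_nsmul_ray (N : Fin d → ℕ) (i : Fin d) :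
    D.form i (∑ j, N j • D.ray j) = N i * D.form i (D.ray i) := by
  simpa using D.form_sum_zsmul_ray (fun j => (N j : ℤ)) i

theorem ext_form {x y : G} (h : ∀ i, D.form i x = D.form i y) : x = y :=
  sub_eq_zero.1 (D.eq_zero_of_form _ fun i => by rw [map_sub, h, sub_self])

theorem cast_form_ray_ne_zero (i : Fin d) : (D.form i (D.ray i) : ℂ) ≠ 0 := by
  exact_mod_cast (D.form_ray_pos i).ne'

theorem exists_mem_vanishingDiff (p : MvPolynomial (Fin d) ℂ) :
    ∃ k, (fun b => MvPolynomial.eval (D.ev b) p) ∈ vanishingDiff G k := by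
  induction p using MvPolynomial.induction_on with
  | C r => exact ⟨1, by simpa using const_mem_vanishingDiff r⟩
  | add p q hp hq =>
    obtain ⟨k, hk⟩ := hp
    obtain ⟨l, hl⟩ := hq
    refine ⟨max k l, ?_⟩
    simp only [map_add]
    exact add_mem (vanishingDiff_mono (le_max_left k l) hk)
      (vanishingDiff_mono (le_max_right k l) hl)
  | mul_X p i hp =>
    obtain ⟨k, hk⟩ := hp
    refine ⟨k + 1, ?_⟩
    have := mul_addHom_mem_vanishingDiff ((Int.castAddHom ℂ).comp (D.form i)) hk
    convert this using 1
    ext b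
    simp [ev]

/-- Newton's formula gives a polynomial on the monoid spanned by the rays. For other `b`, `f` is a
polynomial along the multiples of `b`, infinitely many of which lie in that monoid; so the two
polynomials agree on the whole line, in particular at `b`. -/
theorem exists_mvPolynomial {k : ℕ} {f : S → ℂ} (hf : f ∈ vanishingDiff S k) :
    ∃ p : MvPolynomial (Fin d) ℂ, ∀ b : S, f b = MvPolynomial.eval (D.ev b) p := by
  obtain ⟨p, hp⟩ := exists_mvPolynomial_of_vanishingDiff
    (fun i => (⟨D.ray i, D.ray_mem i⟩ : S)) 0 Finset.univ hf
  -- `p` takes the multiplicities of the rays; dividing by `F_i(ray i)` expresses it in the values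
  -- of the forms.
  let q : MvPolynomial (Fin d) ℂ := MvPolynomial.aeval
    (fun i => MvPolynomial.C ((D.form i (D.ray i) : ℂ)⁻¹) * MvPolynomial.X i) p
  have hq : ∀ z, MvPolynomial.eval z q =
      MvPolynomial.eval (fun i => (D.form i (D.ray i) : ℂ)⁻¹ * z i) p := by
    intro z
    rw [eval_aeval_mvPolynomial]
    congr 2
    ext j
    simp
  refine ⟨q, fun b => ?_⟩
  obtain ⟨r, hr⟩ := exists_mvPolynomial_of_vanishingDiff (fun _ : Fin 1 => b) 0 Finset.univ hf
  let r' : MvPolynomial (Fin 1) ℂ := MvPolynomial.aeval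
    (fun i => MvPolynomial.C (D.ev b i) * MvPolynomial.X 0) q
  have hr' : ∀ z, MvPolynomial.eval z r' = MvPolynomial.eval (z 0 • D.ev b) q := by
    intro z
    rw [eval_aeval_mvPolynomial]
    congr 2
    ext j
    simp [mul_comm]
  -- A common multiple of the `F_i(ray i)`, so that `m • b` is an `ℕ`-combination of rays.
  let m : ℤ := ∏ i, D.form i (D.ray i)
  have hm : 0 < m := Finset.prod_pos fun i _ => D.form_ray_pos i
  obtain ⟨m', hm'⟩ := Int.eq_ofNat_of_zero_le hm.le
  have hdvd : ∀ i, ∃ e : ℕ, D.form i (m' • (b : G)) = e * D.form i (D.ray i) := by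
    intro i
    obtain ⟨e, he⟩ := Finset.dvd_prod_of_mem (fun i => D.form i (D.ray i)) (Finset.mem_univ i)
    have he0 : 0 ≤ e := by
      have h1 : 0 < D.form i (D.ray i) * e := he ▸ hm
      exact (pos_of_mul_pos_right h1 (D.form_ray_pos i).le).le
    obtain ⟨e', rfl⟩ := Int.eq_ofNat_of_zero_le he0
    obtain ⟨g, hg⟩ := Int.eq_ofNat_of_zero_le (D.nonneg i b b.2)
    refine ⟨e' * g, ?_⟩
    rw [map_nsmul, hg, nsmul_eq_mul]
    have : (m' : ℤ) = D.form i (D.ray i) * e' := by rw [← he, ← hm']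
    rw [this]
    push_cast
    ring
  choose e he using hdvd
  have hb : m' • b = ∑ i, e i • (⟨D.ray i, D.ray_mem i⟩ : S) := by
    apply Subtype.ext
    push_cast
    exact D.ext_form fun i => by rw [he, form_sum_nsmul_ray]
  have hrr : r = r' := by
    refine eq_zero_of_eval_translates 0 (fun _ => (m' : ℂ)) ?_ 0 ?_ |> sub_eq_zero.1
    · intro _
      have : m' ≠ 0 := by rintro rfl; simp [hm'] at hm
      exact_mod_cast this
    · intro N _
      have h1 := hr fun i => N i * m'
      have h2 := hp fun i => N 0 * e i
      have h3 : N 0 • m' • b = ∑ i, (N 0 * e i) • (⟨D.ray i, D.ray_mem i⟩ : S) := by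
        rw [hb, Finset.smul_sum]
        exact Finset.sum_congr rfl fun i _ => by rw [mul_smul]
      have h4 : ∀ i, (D.form i (D.ray i) : ℂ)⁻¹ * ((N 0 * m' : ℂ) * D.ev b i) =
          (N 0 * e i : ℕ) := by
        intro i
        have h5 : ((m' • D.form i (b : G) : ℤ) : ℂ) = e i * D.form i (D.ray i) := by
          rw [← map_nsmul, he]
          push_cast
          rfl
        rw [inv_mul_eq_iff_eq_mul₀ (D.cast_form_ray_ne_zero i), ev]
        push_cast at h5 ⊢
        rw [nsmul_eq_mul] at h5
        push_cast at h5
        rw [mul_assoc, h5]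
        ring
      rw [map_sub, sub_eq_zero]
      have h6 : (fun i => (0 : Fin 1 → ℂ) i + (N i : ℂ) * (m' : ℂ)) =
          fun i => ((N i * m' : ℕ) : ℂ) := by
        ext i
        simp
      rw [hr', h6, ← h1, hq]
      simp only [Finset.univ_unique, Fin.default_eq_zero, Finset.sum_singleton, mul_smul]
      rw [h3, h2]
      congr 2
      ext i
      rw [← h4]
      simp [mul_assoc]
  have h1 := hr fun _ => 1
  rw [hrr, hr'] at h1
  simpa using h1

/-! ### Value semigroups and exit polynomials. -/

/-- The numerical semigroup of values of the `i`-th form on `S`. -/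
def values (i : Fin d) : Set ℤ := D.form i '' S

/-- `S` is determined by the values of the forms on it. -/
def Scored : Prop := ∀ a, (∀ i, D.form i a ∈ D.values i) → a ∈ S

theorem nonneg_of_mem_values {i : Fin d} {m : ℤ} (hm : m ∈ D.values i) : 0 ≤ m := by
  obtain ⟨x, hx, rfl⟩ := hm
  exact D.nonneg i x hx

/-- The form takes consecutive values `e`, `e + 1` on `S`. Writing `m = q e + r` with `0 ≤ r < e`
gives `m = (q - r) e + r (e + 1)`, and `m ≥ e²` ensures `q ≥ r`. -/
theorem exists_forall_mem_values (i : Fin d) : ∃ c : ℤ, ∀ m, c ≤ m → m ∈ D.values i := by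
  obtain ⟨x, hx⟩ := D.exists_form_eq_one i
  obtain ⟨s, hs, t, ht, rfl⟩ := D.exists_sub x
  rw [map_sub] at hx
  have he := D.nonneg i t ht
  refine ⟨D.form i t * D.form i t, fun m hm => ?_⟩
  have key : ∀ p q : ℤ, 0 ≤ p → 0 ≤ q → p * D.form i t + q * D.form i s ∈ D.values i := by
    intro p q hp hq
    lift p to ℕ using hp
    lift q to ℕ using hq
    exact ⟨p • t + q • s, S.add_mem (S.nsmul_mem ht p) (S.nsmul_mem hs q), by simp⟩
  rcases he.eq_or_lt with h0 | h0
  · have := key 0 m le_rfl (by nlinarith)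
    rwa [show D.form i s = 1 by omega, mul_one, zero_mul, zero_add] at this
  · have h1 := Int.emod_nonneg m h0.ne'
    have h2 := Int.emod_lt_of_pos m h0
    have h3 := Int.mul_ediv_add_emod m (D.form i t)
    have h4 : D.form i t ≤ m / D.form i t := (Int.le_ediv_iff_mul_le h0).2 hm
    have := key (m / D.form i t - m % D.form i t) (m % D.form i t) (by omega) h1
    convert this using 1
    rw [show D.form i s = D.form i t + 1 by omega]
    linear_combination -h3

/-- The values of the `i`-th form on `S` that leave the value set after translation by `a`. -/
def exitValues (i : Fin d) (a : G) : Set ℤ :=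
  {m | m ∈ D.values i ∧ D.form i a + m ∉ D.values i}

theorem finite_exitValues (i : Fin d) (a : G) : (D.exitValues i a).Finite := by
  obtain ⟨c, hc⟩ := D.exists_forall_mem_values i
  refine (Set.finite_Icc 0 (c - D.form i a)).subset fun m hm => ⟨D.nonneg_of_mem_values hm.1, ?_⟩
  by_contra h
  exact hm.2 (hc _ (by omega))

/-- A polynomial vanishing at the `b ∈ S` with `a + b ∉ S`, for scored `S`. -/
def exitPoly (a : G) : MvPolynomial (Fin d) ℂ :=
  ∏ i, ∏ m ∈ (D.finite_exitValues i a).toFinset, (MvPolynomial.X i - MvPolynomial.C (m : ℂ))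

theorem eval_exitPoly_ne_zero {a : G} {z : Fin d → ℂ} :
    MvPolynomial.eval z (D.exitPoly a) ≠ 0 ↔ ∀ i, ∀ m ∈ D.exitValues i a, z i ≠ m := by
  simp [exitPoly, map_prod, Finset.prod_ne_zero_iff, sub_eq_zero]

theorem exitPoly_ne_zero (a : G) : D.exitPoly a ≠ 0 := by
  refine Finset.prod_ne_zero_iff.2 fun i _ => Finset.prod_ne_zero_iff.2 fun m _ h => ?_
  have := congrArg (MvPolynomial.eval fun _ => (m : ℂ) + 1) h
  simp at this

/-- Evaluation of a polynomial at lattice points. -/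
def polyFun (p : MvPolynomial (Fin d) ℂ) : G → ℂ := fun b => MvPolynomial.eval (D.ev b) p

theorem vanishesOnExit_exitPoly (hD : D.Scored) (a : G) :
    VanishesOnExit S a (D.polyFun (D.exitPoly a)) := by
  intro b hb hab
  by_contra h
  refine hab (hD _ fun i => ?_)
  by_contra hi
  exact D.eval_exitPoly_ne_zero.1 h i (D.form i b) ⟨⟨b, hb, rfl⟩, by rwa [map_add] at hi⟩ rfl

theorem monomialOp_mem (a : G) (p : MvPolynomial (Fin d) ℂ)
    (h : VanishesOnExit S a (D.polyFun p)) :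
    monomialOp S a (D.polyFun p) ∈ diffOp ℂ (AddMonoidAlgebra ℂ S) (AddMonoidAlgebra ℂ S) := by
  obtain ⟨k, hk⟩ := D.exists_mem_vanishingDiff p
  exact ⟨k, monomialOp_mem_diffOpOrder h (vanishingDiff_le_succ k hk)⟩

/-- Translation of polynomials by a lattice point. -/
def translate (a : G) (p : MvPolynomial (Fin d) ℂ) : MvPolynomial (Fin d) ℂ :=
  MvPolynomial.aeval (fun i => MvPolynomial.X i + MvPolynomial.C (D.ev a i)) p

theorem eval_translate (a : G) (p : MvPolynomial (Fin d) ℂ) (z : Fin d → ℂ) :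
    MvPolynomial.eval z (D.translate a p) = MvPolynomial.eval (z + D.ev a) p := by
  rw [translate, eval_aeval_mvPolynomial]
  congr 2
  ext i
  simp

theorem translate_zero (p : MvPolynomial (Fin d) ℂ) : D.translate 0 p = p := by
  refine MvPolynomial.funext fun z => ?_
  rw [eval_translate, show D.ev 0 = 0 by ext; simp [ev], add_zero]

theorem monomialOp_mul_polyFun (a b : G) (p q : MvPolynomial (Fin d) ℂ)
    (hq : VanishesOnExit S b (D.polyFun q)) :
    monomialOp S a (D.polyFun p) * monomialOp S b (D.polyFun q) =
      monomialOp S (a + b) (D.polyFun (D.translate b p * q)) := by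
  rw [monomialOp_mul _ _ _ _ hq]
  congr 1
  ext c
  simp only [polyFun, map_mul, eval_translate, ev_add]
  rw [add_comm (D.ev b)]

end SimplicialForms

/-! ### Ideals of operators: scored implies simple. -/

/-- A set of operators which is closed under addition, and under multiplication by differential
operators on both sides: the image in `End` of a two-sided ideal of `D(ℂ[S])`. -/
structure IsDiffOpIdeal {G : Type*} [AddCommGroup G] (S : AddSubmonoid G)
    (X : Submodule ℂ (Module.End ℂ (AddMonoidAlgebra ℂ S))) : Prop where
  le : ∀ P ∈ X, P ∈ diffOp ℂ (AddMonoidAlgebra ℂ S) (AddMonoidAlgebra ℂ S)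
  mul_left : ∀ P ∈ X, ∀ Q ∈ diffOp ℂ (AddMonoidAlgebra ℂ S) (AddMonoidAlgebra ℂ S), Q * P ∈ X
  mul_right : ∀ P ∈ X, ∀ Q ∈ diffOp ℂ (AddMonoidAlgebra ℂ S) (AddMonoidAlgebra ℂ S), P * Q ∈ X

section

variable {G : Type*} [AddCommGroup G] {S : AddSubmonoid G}

theorem lsmul_mem_diffOp (f : AddMonoidAlgebra ℂ S) :
    Algebra.lsmul ℂ ℂ (AddMonoidAlgebra ℂ S) f ∈
      diffOp ℂ (AddMonoidAlgebra ℂ S) (AddMonoidAlgebra ℂ S) :=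
  ⟨0, fun g x => by simp [mul_left_comm]⟩

namespace IsDiffOpIdeal

variable {X : Submodule ℂ (Module.End ℂ (AddMonoidAlgebra ℂ S))} (hX : IsDiffOpIdeal S X)
include hX

theorem opCommutator_mem {P : Module.End ℂ (AddMonoidAlgebra ℂ S)} (hP : P ∈ X)
    (f : AddMonoidAlgebra ℂ S) : opCommutator ℂ (AddMonoidAlgebra ℂ S) _ f P ∈ X :=
  sub_mem (hX.mul_left P hP _ (lsmul_mem_diffOp f)) (hX.mul_right P hP _ (lsmul_mem_diffOp f))

/-- Nonzero brackets stay in the ideal and lower the order; once all brackets vanish, `P` is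
multiplication by `P 1`. -/
theorem exists_lsmul_mem {k : ℕ} {P : Module.End ℂ (AddMonoidAlgebra ℂ S)} (hP : P ∈ X)
    (h0 : P ≠ 0) (hk : P ∈ diffOpOrder ℂ (AddMonoidAlgebra ℂ S) (AddMonoidAlgebra ℂ S) k) :
    ∃ f : AddMonoidAlgebra ℂ S, f ≠ 0 ∧ Algebra.lsmul ℂ ℂ (AddMonoidAlgebra ℂ S) f ∈ X := by
  induction k generalizing P with
  | zero =>
    have h1 : P = Algebra.lsmul ℂ ℂ (AddMonoidAlgebra ℂ S) (P 1) := by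
      refine LinearMap.ext fun x => ?_
      have := hk x 1
      rw [smul_eq_mul, mul_one] at this
      rw [this, smul_eq_mul, mul_comm]
      rfl
    refine ⟨P 1, fun h => h0 ?_, h1 ▸ hP⟩
    rw [h1, h, map_zero]
  | succ k ih =>
    by_cases h : ∀ f, opCommutator ℂ (AddMonoidAlgebra ℂ S) _ f P = 0
    · exact ih hP h0 (diffOpOrder_mono _ _ _ (Nat.zero_le k)
        (mem_diffOpOrder_zero_of_opCommutator h))
    · push Not at h
      obtain ⟨f, hf⟩ := h
      exact ih (hX.opCommutator_mem hP f) hf (hk f)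

end IsDiffOpIdeal

/-- The derivation of `ℂ[S]` scaling `t^b` by `χ b`. -/
def scaleCoeff (χ : G → ℂ) : Module.End ℂ (AddMonoidAlgebra ℂ S) := monomialOp S 0 χ

theorem scaleCoeff_single (χ : G → ℂ) (b : S) (r : ℂ) :
    scaleCoeff χ (single b r) = single b (r * χ b) := by
  rw [scaleCoeff, monomialOp_single_of_mem _ _ (by simp)]
  simp

theorem scaleCoeff_coeff (χ : G → ℂ) (f : AddMonoidAlgebra ℂ S) (b : S) :
    (scaleCoeff χ f).coeff b = χ b * f.coeff b := by
  classical
  induction f using AddMonoidAlgebra.induction_linear with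
  | zero => simp
  | add f g hf hg => simp [hf, hg, mul_add]
  | single c r =>
    rw [scaleCoeff_single]
    simp only [AddMonoidAlgebra.coeff_single, Finsupp.single_apply]
    split_ifs with h
    · rw [h, mul_comm]
    · simp

theorem scaleCoeff_mul (χ : G →+ ℂ) (f g : AddMonoidAlgebra ℂ S) :
    scaleCoeff χ (f * g) = scaleCoeff χ f * g + f * scaleCoeff χ g := by
  induction f using AddMonoidAlgebra.induction_linear with
  | zero => simp
  | add f f' hf hf' => simp only [add_mul, map_add, hf, hf']; abel
  | single c r =>
    induction g using AddMonoidAlgebra.induction_linear with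
    | zero => simp
    | add g g' hg hg' => simp only [mul_add, map_add, hg, hg']; abel
    | single e s =>
      simp only [single_mul_single, scaleCoeff_single, ← AddMonoidAlgebra.single_add]
      congr 1
      simp
      ring

end

namespace SimplicialForms

variable {G : Type*} [AddCommGroup G] {S : AddSubmonoid G} {d : ℕ} (D : SimplicialForms S d)

theorem scaleCoeff_mem_diffOp (i : Fin d) :
    (scaleCoeff (fun b => (D.form i b : ℂ)) : Module.End ℂ (AddMonoidAlgebra ℂ S)) ∈
      diffOp ℂ (AddMonoidAlgebra ℂ S) (AddMonoidAlgebra ℂ S) := by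
  have := D.monomialOp_mem 0 (MvPolynomial.X i) (fun b hb h => (h (by simpa using hb)).elim)
  have h : D.polyFun (MvPolynomial.X i) = fun b => (D.form i b : ℂ) := by
    ext b
    simp [polyFun, ev]
  rwa [h] at this

variable {X : Submodule ℂ (Module.End ℂ (AddMonoidAlgebra ℂ S))} (hX : IsDiffOpIdeal S X)
include hX

/-- The Euler operator `E` of the form is a derivation, so `[E, f] = E(f)` as multiplication
operators. -/
theorem lsmul_scaleCoeff_mem {f : AddMonoidAlgebra ℂ S}
    (hf : Algebra.lsmul ℂ ℂ (AddMonoidAlgebra ℂ S) f ∈ X) (i : Fin d) :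
    Algebra.lsmul ℂ ℂ (AddMonoidAlgebra ℂ S) (scaleCoeff (fun b => (D.form i b : ℂ)) f) ∈ X := by
  have h1 := sub_mem (hX.mul_left _ hf _ (D.scaleCoeff_mem_diffOp i))
    (hX.mul_right _ hf _ (D.scaleCoeff_mem_diffOp i))
  convert h1 using 1
  refine LinearMap.ext fun x => ?_
  have := scaleCoeff_mul ((Int.castAddHom ℂ).comp (D.form i)) f x
  simp only [LinearMap.sub_apply, Module.End.mul_apply, Algebra.lsmul_coe, smul_eq_mul]
  exact (sub_eq_of_eq_add this).symm

include D in
theorem exists_monomialOp_one_mem (n : ℕ) : ∀ f : AddMonoidAlgebra ℂ S, f ≠ 0 →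
    f.coeff.support.card ≤ n → Algebra.lsmul ℂ ℂ (AddMonoidAlgebra ℂ S) f ∈ X →
    ∃ a : S, monomialOp S (a : G) 1 ∈ X := by
  classical
  induction n with
  | zero =>
    intro f hf hn
    simp_all
  | succ n ih =>
    intro f hf hn hfX
    obtain ⟨a, ha⟩ := Finsupp.support_nonempty_iff.2 (mt AddMonoidAlgebra.coeff_eq_zero.1 hf)
    by_cases hall : ∀ i, ∀ b ∈ f.coeff.support, D.form i b = D.form i a
    · refine ⟨a, ?_⟩
      have h1 : f = single a (f.coeff a) := by
        ext b
        by_cases hb : b = a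
        · simp [hb]
        · have : b ∉ f.coeff.support := fun h =>
            hb (Subtype.ext (D.ext_form fun i => hall i b h))
          rw [Finsupp.notMem_support_iff.1 this, AddMonoidAlgebra.coeff_single,
            Finsupp.single_apply, if_neg (Ne.symm hb)]
      have h2 := X.smul_mem (f.coeff a)⁻¹ hfX
      rwa [h1, single_eq_smul, map_smul, AddMonoidAlgebra.coeff_smul, AddMonoidAlgebra.coeff_single,
        Finsupp.smul_apply, Finsupp.single_eq_same, smul_eq_mul, mul_one,
        inv_smul_smul₀ (Finsupp.mem_support_iff.1 ha), lsmul_single] at h2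
    · push Not at hall
      obtain ⟨i, b, hb, hne⟩ := hall
      -- This kills the term at `a`, keeps the one at `b`, and adds none: the support shrinks but
      -- stays nonempty.
      let g := scaleCoeff (fun b => (D.form i b : ℂ)) f - (D.form i a : ℂ) • f
      have hg : ∀ c : S, g.coeff c = ((D.form i c : ℂ) - D.form i a) * f.coeff c := by
        intro c
        simp only [g, AddMonoidAlgebra.coeff_sub, Finsupp.sub_apply, scaleCoeff_coeff,
          AddMonoidAlgebra.coeff_smul, Finsupp.smul_apply, smul_eq_mul, sub_mul]
      refine ih g ?_ ?_ ?_
      · intro h0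
        have h1 := hg b
        rw [h0, AddMonoidAlgebra.coeff_zero, Finsupp.zero_apply, eq_comm, mul_eq_zero,
          sub_eq_zero] at h1
        rcases h1 with h1 | h1
        · exact hne (by exact_mod_cast h1)
        · exact Finsupp.mem_support_iff.1 hb h1
      · have hss : g.coeff.support ⊂ f.coeff.support := by
          refine Finset.ssubset_iff_subset_ne.2 ⟨fun c hc => ?_, fun h => ?_⟩
          · rw [Finsupp.mem_support_iff, hg] at hc
            exact Finsupp.mem_support_iff.2 (right_ne_zero_of_mul hc)
          · rw [← h, Finsupp.mem_support_iff, hg, sub_self, zero_mul] at ha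
            exact ha rfl
        have := Finset.card_lt_card hss
        omega
      · rw [map_sub, map_smul]
        exact sub_mem (D.lsmul_scaleCoeff_mem hX hfX i) (X.smul_mem _ hfX)

/-- The polynomials which lie in an ideal of differential operators. -/
def polyIdeal : Ideal (MvPolynomial (Fin d) ℂ) where
  carrier := {p | monomialOp S 0 (D.polyFun p) ∈ X}
  zero_mem' := by
    have h := D.monomialOp_mem 0 (0 : MvPolynomial (Fin d) ℂ) (fun b hb h => by simp [polyFun])
    have h0 : monomialOp S 0 (D.polyFun 0) = 0 := by
      refine end_ext fun b => ?_
      rw [monomialOp_of_mem _ (by simp)]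
      simp [polyFun]
    change monomialOp S 0 (D.polyFun 0) ∈ X
    rw [h0]
    exact zero_mem _
  add_mem' := by
    intro p q hp hq
    have h0 : monomialOp S 0 (D.polyFun (p + q)) =
        monomialOp S 0 (D.polyFun p) + monomialOp S 0 (D.polyFun q) := by
      refine end_ext fun b => ?_
      rw [LinearMap.add_apply, monomialOp_of_mem _ (by simp), monomialOp_of_mem _ (by simp),
        monomialOp_of_mem _ (by simp), ← AddMonoidAlgebra.single_add]
      simp [polyFun]
    change monomialOp S 0 (D.polyFun (p + q)) ∈ X
    rw [h0]
    exact add_mem hp hq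
  smul_mem' := by
    intro q p hp
    have hv : ∀ r, VanishesOnExit S 0 (D.polyFun r) :=
      fun r b hb h => (h (by simpa using hb)).elim
    have h := hX.mul_left _ hp _ (D.monomialOp_mem 0 q (hv q))
    rw [monomialOp_mul_polyFun _ _ _ _ _ (hv p), add_zero] at h
    rwa [translate_zero] at h

theorem mem_polyIdeal {p : MvPolynomial (Fin d) ℂ} :
    p ∈ D.polyIdeal hX ↔ monomialOp S 0 (D.polyFun p) ∈ X := Iff.rfl

/-- Sandwich `p` between the exit operators of degrees `-a` and `a`. -/
theorem mul_mem_polyIdeal (hD : D.Scored) {p : MvPolynomial (Fin d) ℂ} (hp : p ∈ D.polyIdeal hX)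
    (a : G) : D.translate a (D.exitPoly (-a) * p) * D.exitPoly a ∈ D.polyIdeal hX := by
  have hv : ∀ r, VanishesOnExit S 0 (D.polyFun r) :=
    fun r b hb h => (h (by simpa using hb)).elim
  have h1 := hX.mul_left _ hp _ (D.monomialOp_mem _ _ (D.vanishesOnExit_exitPoly hD (-a)))
  have h2 := hX.mul_right _ h1 _ (D.monomialOp_mem _ _ (D.vanishesOnExit_exitPoly hD a))
  rw [monomialOp_mul_polyFun _ _ _ _ _ (hv p),
    monomialOp_mul_polyFun _ _ _ _ _ (D.vanishesOnExit_exitPoly hD a)] at h2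
  rwa [translate_zero, add_zero, neg_add_cancel] at h2

theorem exists_mem_polyIdeal_ne_zero (hD : D.Scored) {a : S} (ha : monomialOp S (a : G) 1 ∈ X) :
    ∃ p ∈ D.polyIdeal hX, p ≠ 0 := by
  have h := hX.mul_left _ ha _ (D.monomialOp_mem _ _ (D.vanishesOnExit_exitPoly hD (-(a : G))))
  have h1 : (1 : G → ℂ) = D.polyFun 1 := by ext; simp [polyFun]
  rw [h1, monomialOp_mul_polyFun _ _ _ _ _
    (fun b hb h => (h (S.add_mem a.2 hb)).elim), neg_add_cancel, mul_one] at h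
  refine ⟨_, h, fun h0 => D.exitPoly_ne_zero (-(a : G)) (MvPolynomial.funext fun z => ?_)⟩
  have := congrArg (MvPolynomial.eval (z - D.ev (a : G))) h0
  rwa [eval_translate, sub_add_cancel] at this

omit hX in
theorem exists_eval_exitPoly_ne_zero (z : Fin d → ℂ) : ∃ (ε : Fin d → ℤ) (n : ℕ),
    (∀ i, ε i ≠ 0) ∧ ∀ N : Fin d → ℕ, (∀ i, n ≤ N i) →
      ∃ a : G, D.ev a = (fun i => (N i : ℂ) * (ε i * D.form i (D.ray i))) ∧
        MvPolynomial.eval z (D.exitPoly a) ≠ 0 ∧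
        MvPolynomial.eval (z + D.ev a) (D.exitPoly (-a)) ≠ 0 := by
  classical
  choose c hc using D.exists_forall_mem_values
  -- If `z i` is a value, a large upward step lands among the values again. If it is not, step down:
  -- landing on a value would make `z i` an integer beyond `c i`, hence a value.
  let ε : Fin d → ℤ := fun i => if ∃ m ∈ D.values i, z i = m then 1 else -1
  refine ⟨ε, ∑ i, (c i).toNat, fun i => ?_, fun N hN => ?_⟩
  · simp only [ε]
    split_ifs <;> simp
  have hN' : ∀ i, c i ≤ N i * D.form i (D.ray i) := by
    intro i
    have h1 := (Finset.single_le_sum (f := fun i => (c i).toNat) (fun _ _ => Nat.zero_le _)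
      (Finset.mem_univ i)).trans (hN i)
    have h2 := D.form_ray_pos i
    have h3 : c i ≤ N i := by
      have := Int.self_le_toNat (c i)
      omega
    nlinarith
  let a : G := ∑ j, ((N j : ℤ) * ε j) • D.ray j
  have ha : ∀ i, D.form i a = N i * ε i * D.form i (D.ray i) := fun i =>
    D.form_sum_zsmul_ray (fun j => (N j : ℤ) * ε j) i
  have hev : D.ev a = fun i => (N i : ℂ) * (ε i * D.form i (D.ray i)) := by
    ext i
    rw [ev, ha]
    push_cast
    ring
  refine ⟨a, hev, D.eval_exitPoly_ne_zero.2 ?_, D.eval_exitPoly_ne_zero.2 ?_⟩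
  · rintro i m ⟨hm, hma⟩ hz
    refine hma (hc i _ ?_)
    have h1 : ε i = 1 := if_pos ⟨m, hm, hz⟩
    have := D.nonneg_of_mem_values hm
    have := hN' i
    rw [ha, h1, mul_one]
    omega
  · rintro i m ⟨hm, hma⟩ hz
    rw [Pi.add_apply, ev] at hz
    have hz' : z i = ((m - D.form i a : ℤ) : ℂ) := by
      push_cast
      rw [← hz]
      ring
    rw [map_neg] at hma
    by_cases h : ∃ m ∈ D.values i, z i = m
    · obtain ⟨m', hm', hz''⟩ := h
      refine hma ?_
      rw [hz''] at hz'
      have : m' = m - D.form i a := by exact_mod_cast hz'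
      rwa [neg_add_eq_sub, ← this]
    · refine h ⟨_, hc i _ ?_, hz'⟩
      have h1 : ε i = -1 := if_neg h
      have := D.nonneg_of_mem_values hm
      have := hN' i
      rw [ha, h1]
      linarith

theorem polyIdeal_eq_top (hD : D.Scored) (h : ∃ p ∈ D.polyIdeal hX, p ≠ 0) :
    D.polyIdeal hX = ⊤ := by
  rw [← Ideal.radical_eq_top, ← MvPolynomial.vanishingIdeal_zeroLocus_eq_radical (K := ℂ)]
  suffices hz : MvPolynomial.zeroLocus ℂ (D.polyIdeal hX) = ∅ by
    rw [hz, MvPolynomial.vanishingIdeal_empty]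
  refine Set.eq_empty_of_forall_notMem fun z hz => ?_
  rw [MvPolynomial.mem_zeroLocus_iff] at hz
  simp only [MvPolynomial.aeval_eq_eval] at hz
  obtain ⟨p, hp, hp0⟩ := h
  obtain ⟨ε, n, hε, hN⟩ := D.exists_eval_exitPoly_ne_zero z
  refine hp0 (eq_zero_of_eval_translates z (fun i => ε i * D.form i (D.ray i)) ?_ n ?_)
  · intro i
    exact mul_ne_zero (by exact_mod_cast hε i) (D.cast_form_ray_ne_zero i)
  · intro N hNn
    obtain ⟨a, hev, h1, h2⟩ := hN N hNn
    have h3 := hz _ (D.mul_mem_polyIdeal hX hD hp a)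
    rw [map_mul, eval_translate, map_mul] at h3
    have h4 := (mul_eq_zero.1 ((mul_eq_zero.1 h3).resolve_right h1)).resolve_left h2
    rwa [hev] at h4

theorem one_mem_of_ne_zero (hD : D.Scored) {P : Module.End ℂ (AddMonoidAlgebra ℂ S)}
    (hP : P ∈ X) (h0 : P ≠ 0) : 1 ∈ X := by
  obtain ⟨k, hk⟩ := hX.le P hP
  obtain ⟨f, hf0, hf⟩ := hX.exists_lsmul_mem hP h0 hk
  obtain ⟨a, ha⟩ := D.exists_monomialOp_one_mem hX _ f hf0 le_rfl hf
  have h := D.polyIdeal_eq_top hX hD (D.exists_mem_polyIdeal_ne_zero hX hD ha)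
  rw [Ideal.eq_top_iff_one, mem_polyIdeal] at h
  convert h
  refine end_ext fun b => ?_
  rw [monomialOp_of_mem _ (by simp)]
  simp [polyFun]

end SimplicialForms

/-- The operators lying in a two-sided ideal of `D(ℂ[S])`. -/
def operatorSubmodule {G : Type*} [AddCommGroup G] (S : AddSubmonoid G)
    (I : TwoSidedIdeal (diffOp ℂ (AddMonoidAlgebra ℂ S) (AddMonoidAlgebra ℂ S))) :
    Submodule ℂ (Module.End ℂ (AddMonoidAlgebra ℂ S)) where
  carrier := Subtype.val '' {P | P ∈ I}
  zero_mem' := ⟨0, I.zero_mem, rfl⟩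
  add_mem' := by
    rintro _ _ ⟨P, hP, rfl⟩ ⟨Q, hQ, rfl⟩
    exact ⟨P + Q, I.add_mem hP hQ, rfl⟩
  smul_mem' := by
    rintro r _ ⟨P, hP, rfl⟩
    refine ⟨algebraMap ℂ _ r * P, I.mul_mem_left _ _ hP, ?_⟩
    rw [← Algebra.smul_def]
    rfl

theorem isDiffOpIdeal_operatorSubmodule {G : Type*} [AddCommGroup G] (S : AddSubmonoid G)
    (I : TwoSidedIdeal (diffOp ℂ (AddMonoidAlgebra ℂ S) (AddMonoidAlgebra ℂ S))) :
    IsDiffOpIdeal S (operatorSubmodule S I) where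
  le := by
    rintro _ ⟨P, _, rfl⟩
    exact P.2
  mul_left := by
    rintro _ ⟨P, hP, rfl⟩ Q hQ
    exact ⟨⟨Q, hQ⟩ * P, I.mul_mem_left _ _ hP, rfl⟩
  mul_right := by
    rintro _ ⟨P, hP, rfl⟩ Q hQ
    exact ⟨P * ⟨Q, hQ⟩, I.mul_mem_right _ _ hP, rfl⟩

theorem SimplicialForms.isSimpleRing_of_scored {G : Type*} [AddCommGroup G] {S : AddSubmonoid G}
    {d : ℕ} (D : SimplicialForms S d) (hD : D.Scored) :
    IsSimpleRing (diffOp ℂ (AddMonoidAlgebra ℂ S) (AddMonoidAlgebra ℂ S)) := by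
  refine IsSimpleRing.of_eq_bot_or_eq_top fun I => or_iff_not_imp_left.2 fun hI => ?_
  obtain ⟨P, hP, hP0⟩ := SetLike.exists_of_lt (bot_lt_iff_ne_bot.2 hI)
  have h2 : (P : Module.End ℂ (AddMonoidAlgebra ℂ S)) ≠ 0 := fun h =>
    hP0 ((TwoSidedIdeal.mem_bot _).2 (Subtype.ext h))
  obtain ⟨Q, hQ, hQ1⟩ := D.one_mem_of_ne_zero (isDiffOpIdeal_operatorSubmodule S I) hD
    ⟨P, hP, rfl⟩ h2
  have h3 : Q = 1 := Subtype.ext hQ1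
  exact I.one_mem_iff.1 (h3 ▸ hQ)

/-! ### Extension to `ℂ[G]`: simple implies scored. -/

namespace SimplicialForms

variable {G : Type*} [AddCommGroup G] {S : AddSubmonoid G} {d : ℕ} (D : SimplicialForms S d)

/-- The operator `t^b ↦ p(b) t^{a+b}` on `ℂ[G]`. -/
def latticeOp (a : G) (p : MvPolynomial (Fin d) ℂ) : Module.End ℂ (AddMonoidAlgebra ℂ G) :=
  (AddMonoidAlgebra.basis G ℂ).constr ℂ fun b => single (a + b) (D.polyFun p b)

theorem latticeOp_single (a : G) (p : MvPolynomial (Fin d) ℂ) (b : G) (r : ℂ) :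
    D.latticeOp a p (single b r) = single (a + b) (r * D.polyFun p b) := by
  have := (AddMonoidAlgebra.basis G ℂ).constr_basis ℂ
    (fun b => (single (a + b) (D.polyFun p b) : AddMonoidAlgebra ℂ G)) b
  rw [AddMonoidAlgebra.basis_apply] at this
  rw [latticeOp, single_eq_smul, map_smul, this, AddMonoidAlgebra.smul_single, smul_eq_mul]

theorem latticeOp_mul (a b : G) (p q : MvPolynomial (Fin d) ℂ) :
    D.latticeOp a p * D.latticeOp b q = D.latticeOp (a + b) (D.translate b p * q) := by
  refine end_ext fun c => ?_
  rw [Module.End.mul_apply]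
  simp only [latticeOp_single, polyFun, map_mul, eval_translate, ev_add]
  rw [add_assoc, add_comm (D.ev b)]
  congr 1
  ring

/-- The algebra of polynomial differential operators on `ℂ[G]`, as a space of endomorphisms. -/
def polyOps : Submodule ℂ (Module.End ℂ (AddMonoidAlgebra ℂ G)) :=
  Submodule.span ℂ (Set.range fun x : G × MvPolynomial (Fin d) ℂ => D.latticeOp x.1 x.2)

theorem latticeOp_mem_polyOps (a : G) (p : MvPolynomial (Fin d) ℂ) :
    D.latticeOp a p ∈ D.polyOps :=
  Submodule.subset_span ⟨(a, p), rfl⟩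

theorem mul_mem_polyOps {Φ Ψ : Module.End ℂ (AddMonoidAlgebra ℂ G)} (hΦ : Φ ∈ D.polyOps)
    (hΨ : Ψ ∈ D.polyOps) : Φ * Ψ ∈ D.polyOps := by
  have h : D.polyOps * D.polyOps ≤ D.polyOps := by
    rw [polyOps, Submodule.span_mul_span, Submodule.span_le]
    rintro _ ⟨_, ⟨x, rfl⟩, _, ⟨y, rfl⟩, rfl⟩
    change D.latticeOp x.1 x.2 * D.latticeOp y.1 y.2 ∈ D.polyOps
    rw [latticeOp_mul]
    exact D.latticeOp_mem_polyOps _ _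
  exact h (Submodule.mul_mem_mul hΦ hΨ)

theorem exists_coeff_eq_polyFun {Φ : Module.End ℂ (AddMonoidAlgebra ℂ G)} (hΦ : Φ ∈ D.polyOps)
    (a : G) : ∃ p, ∀ b, (Φ (single b 1)).coeff (a + b) = D.polyFun p b := by
  classical
  induction hΦ using Submodule.span_induction with
  | mem Φ h =>
    obtain ⟨⟨c, q⟩, rfl⟩ := h
    by_cases hc : c = a
    · exact ⟨q, fun b => by simp [latticeOp_single, hc]⟩
    · exact ⟨0, fun b => by simp [latticeOp_single, hc, polyFun]⟩
  | zero => exact ⟨0, fun b => by simp [polyFun]⟩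
  | add Φ Ψ _ _ h1 h2 =>
    obtain ⟨p, hp⟩ := h1
    obtain ⟨q, hq⟩ := h2
    exact ⟨p + q, fun b => by
      rw [LinearMap.add_apply, AddMonoidAlgebra.coeff_add, Finsupp.add_apply, hp, hq]
      simp [polyFun]⟩
  | smul r Φ _ h1 =>
    obtain ⟨p, hp⟩ := h1
    exact ⟨MvPolynomial.C r * p, fun b => by
      rw [LinearMap.smul_apply, AddMonoidAlgebra.coeff_smul, Finsupp.smul_apply, hp]
      simp [polyFun]⟩

/-- `Φ` is an extension of `P` to a polynomial differential operator on `ℂ[G]`. -/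
def IsExtension (Φ : Module.End ℂ (AddMonoidAlgebra ℂ G))
    (P : Module.End ℂ (AddMonoidAlgebra ℂ S)) : Prop :=
  Φ ∈ D.polyOps ∧ ∀ x, Φ (incl S x) = incl S (P x)

theorem exists_isExtension (T : Set S) (hT : AddSubmonoid.closure T = ⊤) (hfin : T.Finite)
    {P : Module.End ℂ (AddMonoidAlgebra ℂ S)}
    (hP : P ∈ diffOp ℂ (AddMonoidAlgebra ℂ S) (AddMonoidAlgebra ℂ S)) :
    ∃ Φ, D.IsExtension Φ P := by
  classical
  obtain ⟨k, hk⟩ := hP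
  choose p hp using fun a => D.exists_mvPolynomial (component_mem_vanishingDiff hk a)
  have hF := finite_component_ne_zero T hT hfin hk
  refine ⟨∑ a ∈ hF.toFinset, D.latticeOp a (p a),
    Submodule.sum_mem _ fun a _ => D.latticeOp_mem_polyOps _ _, fun x => ?_⟩
  have h : (∑ a ∈ hF.toFinset, D.latticeOp a (p a)) ∘ₗ (incl S).toLinearMap =
      (incl S).toLinearMap ∘ₗ P := by
    refine end_ext fun b => ?_
    ext z
    obtain ⟨a, rfl⟩ : ∃ a, z = a + (b : G) := ⟨z - b, by simp⟩
    have h1 : ((incl S) (P (single b 1))).coeff (a + (b : G)) = component P a b := rfl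
    simp only [LinearMap.comp_apply, AlgHom.toLinearMap_apply, incl_single, LinearMap.sum_apply,
      latticeOp_single, AddMonoidAlgebra.coeff_sum, AddMonoidAlgebra.coeff_single,
      Finsupp.finsetSum_apply, one_mul, Finsupp.single_apply, add_left_inj, h1]
    rw [Finset.sum_ite_eq']
    split_ifs with ha
    · rw [hp]
      rfl
    · have : component P a = 0 := by simpa using ha
      rw [this]
      rfl
  exact LinearMap.congr_fun h x

/-- The elements of `G` whose forms take values of the forms on `S`. -/
def scoredClosure : Set G := {a | ∀ i, D.form i a ∈ D.values i}

theorem mem_range_incl {x : AddMonoidAlgebra ℂ G} :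
    x ∈ LinearMap.range (incl S).toLinearMap ↔ ∀ z ∉ S, x.coeff z = 0 := by
  constructor
  · rintro ⟨y, rfl⟩ z hz
    exact incl_coeff_of_notMem y hz
  · intro h
    rw [← AddMonoidAlgebra.sum_coeff_single x]
    refine Submodule.sum_mem _ fun z hz => ?_
    have hzS : z ∈ S := by
      by_contra hzS
      exact Finsupp.mem_support_iff.1 hz (h z hzS)
    exact ⟨single ⟨z, hzS⟩ (x.coeff z), by simp⟩

/-- The span of the `t^b` for `b` in the scored closure. -/
def closureSpan : Submodule ℂ (AddMonoidAlgebra ℂ G) :=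
  AddMonoidAlgebra.supported ℂ ℂ D.scoredClosure

theorem map_mem_closureSpan {Φ : Module.End ℂ (AddMonoidAlgebra ℂ G)}
    {N : Submodule ℂ (AddMonoidAlgebra ℂ G)}
    (h : ∀ b ∈ D.scoredClosure, Φ (single b 1) ∈ N) {x : AddMonoidAlgebra ℂ G}
    (hx : x ∈ D.closureSpan) : Φ x ∈ N := by
  have h1 : D.closureSpan ≤ N.comap Φ := by
    rw [closureSpan, AddMonoidAlgebra.supported_eq_span_single, Submodule.span_le]
    rintro _ ⟨b, hb, rfl⟩
    exact h b hb
  exact h1 hx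

/-- Suppose `b` is in the closure and `F_i(a + b)` is not a value. Take `c ∈ S` with `F_i(c) =
F_i(b)`. Adding rays other than the `i`-th to `c` stays in `S`, and translation by `a` leaves `S`,
so the coefficient polynomial vanishes there; these points are dense in the hyperplane through `b`.
-/
theorem IsExtension.map_closureSpan {Φ : Module.End ℂ (AddMonoidAlgebra ℂ G)}
    {P : Module.End ℂ (AddMonoidAlgebra ℂ S)} (h : D.IsExtension Φ P) {x : AddMonoidAlgebra ℂ G}
    (hx : x ∈ D.closureSpan) : Φ x ∈ D.closureSpan := by
  refine D.map_mem_closureSpan (fun b hb => ?_) hx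
  rw [closureSpan, AddMonoidAlgebra.mem_supported']
  intro z hz
  obtain ⟨a, rfl⟩ : ∃ a, z = a + b := ⟨z - b, by simp⟩
  obtain ⟨p, hp⟩ := D.exists_coeff_eq_polyFun h.1 a
  simp only [scoredClosure, Set.mem_ofPred_eq, not_forall] at hz
  obtain ⟨i, hi⟩ := hz
  obtain ⟨c, hc, hcb⟩ := hb i
  rw [hp]
  refine eval_eq_zero_of_eval_translates_hyperplane (D.ev c) _ D.cast_form_ray_ne_zero i ?_
    (by simp only [ev, hcb])
  intro N hN
  have hcN : c + ∑ j, N j • D.ray j ∈ S :=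
    S.add_mem hc (S.sum_mem fun j _ => S.nsmul_mem (D.ray_mem j) _)
  have h1 := hp (c + ∑ j, N j • D.ray j)
  have h2 := h.2 (single ⟨_, hcN⟩ 1)
  rw [incl_single] at h2
  rw [h2, incl_coeff_of_notMem] at h1
  · rw [h1, polyFun]
    congr 2
    ext j
    simp only [ev, map_add, form_sum_nsmul_ray]
    push_cast
    rfl
  · intro hmem
    refine hi ⟨_, hmem, ?_⟩
    rw [map_add, map_add, form_sum_nsmul_ray, hN, hcb, map_add]
    simp

/-- The coefficient polynomials of `Φ - 1` vanish on the ray monoid, which is Zariski dense. -/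
theorem IsExtension.eq_of_one {Φ : Module.End ℂ (AddMonoidAlgebra ℂ G)}
    (h : D.IsExtension Φ 1) : Φ = 1 := by
  have h0 : 1 = D.latticeOp 0 1 := by
    refine end_ext fun b => ?_
    simp [latticeOp_single, polyFun]
  have h1 : Φ - 1 ∈ D.polyOps := sub_mem h.1 (h0 ▸ D.latticeOp_mem_polyOps 0 1)
  refine sub_eq_zero.1 (end_ext fun b => ?_)
  ext z
  obtain ⟨a, rfl⟩ : ∃ a, z = a + b := ⟨z - b, by simp⟩
  obtain ⟨p, hp⟩ := D.exists_coeff_eq_polyFun h1 a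
  have hp0 : p = 0 := by
    refine eq_zero_of_eval_translates 0 _ D.cast_form_ray_ne_zero 0 fun N _ => ?_
    have hN : ∑ j, N j • D.ray j ∈ S := S.sum_mem fun j _ => S.nsmul_mem (D.ray_mem j) _
    have h2 := hp (∑ j, N j • D.ray j)
    have h3 := h.2 (single ⟨_, hN⟩ 1)
    rw [incl_single, Module.End.one_apply, incl_single] at h3
    rw [LinearMap.sub_apply, h3, Module.End.one_apply, sub_self] at h2
    rw [AddMonoidAlgebra.coeff_zero, Finsupp.zero_apply, polyFun] at h2
    rw [h2]
    congr 2
    ext j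
    rw [ev, form_sum_nsmul_ray]
    simp
  rw [hp, hp0]
  simp [polyFun]

/-- The differential operators on `ℂ[S]` which extend to operators mapping the span of the scored
closure into `ℂ[S]`. -/
def conductorIdeal (hS : ∃ T : Set S, AddSubmonoid.closure T = ⊤ ∧ T.Finite) :
    TwoSidedIdeal (diffOp ℂ (AddMonoidAlgebra ℂ S) (AddMonoidAlgebra ℂ S)) :=
  TwoSidedIdeal.mk'
    {P | ∃ Φ, D.IsExtension Φ P.1 ∧
      ∀ x ∈ D.closureSpan, Φ x ∈ LinearMap.range (incl S).toLinearMap}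
    ⟨0, ⟨zero_mem _, fun x => by simp⟩, fun x _ => by simp⟩
    (by
      rintro P Q ⟨Φ, ⟨h1, h2⟩, h3⟩ ⟨Ψ, ⟨h4, h5⟩, h6⟩
      refine ⟨Φ + Ψ, ⟨add_mem h1 h4, fun x => ?_⟩, fun x hx => add_mem (h3 x hx) (h6 x hx)⟩
      rw [LinearMap.add_apply, h2, h5, ← map_add]
      rfl)
    (by
      rintro P ⟨Φ, ⟨h1, h2⟩, h3⟩
      refine ⟨-Φ, ⟨neg_mem h1, fun x => ?_⟩, fun x hx => neg_mem (h3 x hx)⟩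
      rw [LinearMap.neg_apply, h2, ← map_neg]
      rfl)
    (by
      rintro P Q ⟨Φ, ⟨h1, h2⟩, h3⟩
      obtain ⟨T, hT, hfin⟩ := hS
      -- Left multiples: `Ψ` preserves `ℂ[S]`.
      obtain ⟨Ψ, h4, h5⟩ := D.exists_isExtension T hT hfin P.2
      refine ⟨Ψ * Φ, ⟨D.mul_mem_polyOps h4 h1, fun x => ?_⟩, fun x hx => ?_⟩
      · rw [Module.End.mul_apply, h2, h5]
        rfl
      · obtain ⟨y, hy⟩ := h3 x hx
        refine ⟨P.1 y, ?_⟩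
        rw [Module.End.mul_apply, ← hy]
        exact (h5 y).symm)
    (by
      rintro P Q ⟨Φ, ⟨h1, h2⟩, h3⟩
      obtain ⟨T, hT, hfin⟩ := hS
      -- Right multiples: `Ψ` preserves the span of the closure.
      obtain ⟨Ψ, h4⟩ := D.exists_isExtension T hT hfin Q.2
      refine ⟨Φ * Ψ, ⟨D.mul_mem_polyOps h1 h4.1, fun x => ?_⟩, fun x hx => ?_⟩
      · rw [Module.End.mul_apply, h4.2, h2]
        rfl
      · exact h3 _ (h4.map_closureSpan D hx))

theorem mem_conductorIdeal (hS : ∃ T : Set S, AddSubmonoid.closure T = ⊤ ∧ T.Finite)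
    (P : diffOp ℂ (AddMonoidAlgebra ℂ S) (AddMonoidAlgebra ℂ S)) :
    P ∈ D.conductorIdeal hS ↔ ∃ Φ, D.IsExtension Φ P.1 ∧
      ∀ x ∈ D.closureSpan, Φ x ∈ LinearMap.range (incl S).toLinearMap :=
  TwoSidedIdeal.mem_mk' _ _ _ _ _ _ _

/-- Modulo the rays, `b` reduces to one of finitely many remainders `r = s r - t r` in a box; adding
all the `t r` at once clears every denominator. -/
theorem exists_conductor :
    ∃ c ∈ S, ∀ b, (∀ i, 0 ≤ D.form i b) → c + b ∈ S := by
  classical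
  let B : Set G := {r | ∀ i, D.form i r ∈ Set.Ico 0 (D.form i (D.ray i))}
  have hB : B.Finite := by
    have h1 : (Set.univ.pi fun i => Set.Ico 0 (D.form i (D.ray i))).Finite :=
      Set.Finite.pi fun i => Set.finite_Ico _ _
    refine Set.Finite.of_finite_image (f := fun r i => D.form i r) (h1.subset ?_) ?_
    · rintro _ ⟨r, hr, rfl⟩ i _
      exact hr i
    · intro x _ y _ hxy
      exact D.ext_form fun i => congrFun hxy i
  choose s hs t ht hst using D.exists_sub
  refine ⟨∑ r ∈ hB.toFinset, t r, S.sum_mem fun r _ => ht r, fun b hb => ?_⟩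
  let r : G := b - ∑ j, (D.form j b / D.form j (D.ray j)) • D.ray j
  have hr : ∀ i, D.form i r = D.form i b % D.form i (D.ray i) := by
    intro i
    rw [map_sub, form_sum_zsmul_ray]
    have := Int.mul_ediv_add_emod (D.form i b) (D.form i (D.ray i))
    linear_combination -this
  have hrB : r ∈ hB.toFinset := by
    rw [Set.Finite.mem_toFinset]
    intro i
    rw [hr]
    exact ⟨Int.emod_nonneg _ (D.form_ray_pos i).ne', Int.emod_lt_of_pos _ (D.form_ray_pos i)⟩
  have hsum : ∑ j, (D.form j b / D.form j (D.ray j)) • D.ray j ∈ S := by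
    refine S.sum_mem fun j _ => ?_
    obtain ⟨e, he⟩ := Int.eq_ofNat_of_zero_le (Int.ediv_nonneg (hb j) (D.form_ray_pos j).le)
    rw [he, natCast_zsmul]
    exact S.nsmul_mem (D.ray_mem j) e
  have hb' : b = r + ∑ j, (D.form j b / D.form j (D.ray j)) • D.ray j := by simp [r]
  have h3 : ∑ r ∈ hB.toFinset, t r + b = (∑ x ∈ hB.toFinset.erase r, t x + s r) +
      ∑ j, (D.form j b / D.form j (D.ray j)) • D.ray j := by
    conv_lhs => rw [hb']
    rw [← Finset.sum_erase_add _ _ hrB]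
    have h4 : s r = r + t r := (sub_eq_iff_eq_add.1 (hst r).symm)
    rw [h4]
    abel
  rw [h3]
  exact S.add_mem (S.add_mem (S.sum_mem fun x _ => ht x) (hs r)) hsum

theorem scored_of_isSimpleRing (hS : ∃ T : Set S, AddSubmonoid.closure T = ⊤ ∧ T.Finite)
    (h : IsSimpleRing (diffOp ℂ (AddMonoidAlgebra ℂ S) (AddMonoidAlgebra ℂ S))) :
    D.Scored := by
  intro b hb
  obtain ⟨c, hc, hcond⟩ := D.exists_conductor
  let P : diffOp ℂ (AddMonoidAlgebra ℂ S) (AddMonoidAlgebra ℂ S) :=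
    ⟨_, lsmul_mem_diffOp (single (⟨c, hc⟩ : S) 1)⟩
  have hP : P ∈ D.conductorIdeal hS := by
    refine (D.mem_conductorIdeal hS P).2 ⟨D.latticeOp c 1, ⟨D.latticeOp_mem_polyOps c 1, ?_⟩, ?_⟩
    · have h1 : D.latticeOp c 1 ∘ₗ (incl S).toLinearMap = (incl S).toLinearMap ∘ₗ P.1 := by
        refine end_ext fun x => ?_
        simp only [LinearMap.comp_apply, AlgHom.toLinearMap_apply, incl_single, latticeOp_single, P,
          Algebra.lsmul_coe, smul_eq_mul, single_mul_single]
        simp [polyFun]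
      exact fun x => LinearMap.congr_fun h1 x
    · refine fun x hx => D.map_mem_closureSpan (fun z hz => ?_) hx
      have hz : c + z ∈ S := hcond z fun i => D.nonneg_of_mem_values (hz i)
      rw [latticeOp_single]
      exact ⟨single ⟨c + z, hz⟩ (1 * D.polyFun 1 z), by simp⟩
  have hP0 : P ≠ 0 := by
    intro h0
    have h1 : P.1 1 = 0 := by rw [h0]; rfl
    have h2 : P.1 1 = single (⟨c, hc⟩ : S) 1 := by simp [P]
    rw [h2, AddMonoidAlgebra.single_eq_zero] at h1
    exact one_ne_zero h1
  have h1 := IsSimpleRing.one_mem_of_ne_zero_mem _ hP0 hP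
  obtain ⟨Φ, hΦ, hΦ'⟩ := (D.mem_conductorIdeal hS 1).1 h1
  have hΦ1 : Φ = 1 := IsExtension.eq_of_one D hΦ
  have h2 := hΦ' (single b 1) (by
    rw [closureSpan, AddMonoidAlgebra.mem_supported']
    intro z hz
    have : b ≠ z := by rintro rfl; exact hz hb
    simp [this])
  by_contra hbS
  have h3 := mem_range_incl.1 h2 b hbS
  simp [hΦ1] at h3

end SimplicialForms

/-! ### Facets and integral forms of a simplicial cone. -/

section SimplicialCone

variable {d n : ℕ} (A : Matrix (Fin d) (Fin n) ℤ)

theorem toReal_add (a b : Fin d → ℤ) : toReal (a + b) = toReal a + toReal b := by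
  ext i
  simp [toReal]

/-- `toReal` as an additive homomorphism. -/
def toRealHom (d : ℕ) : (Fin d → ℤ) →+ (Fin d → ℝ) where
  toFun := toReal
  map_zero' := by ext i; simp [toReal]
  map_add' := toReal_add

theorem toReal_injective : Function.Injective (toReal (d := d)) := by
  intro a b h
  ext i
  have := congrFun h i
  simpa [toReal] using this

theorem span_cone_eq_top (hA : intSpan A = ⊤) :
    Submodule.span ℝ (cone A : Set (Fin d → ℝ)) = ⊤ := by
  have h1 : ∀ a : Fin d → ℤ, toReal a ∈ Submodule.span ℝ (cone A : Set (Fin d → ℝ)) := by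
    intro a
    have h : intSpan A ≤ (Submodule.span ℝ (cone A : Set (Fin d → ℝ))).toAddSubgroup.comap
        (toRealHom d) := by
      rw [intSpan, AddSubgroup.closure_le]
      rintro _ ⟨j, rfl⟩
      exact Submodule.subset_span (PointedCone.subset_hull ⟨j, rfl⟩)
    exact h (hA ▸ AddSubgroup.mem_top a)
  rw [eq_top_iff, ← (Pi.basisFun ℝ (Fin d)).span_eq, Submodule.span_le]
  rintro _ ⟨i, rfl⟩
  have h2 : Pi.basisFun ℝ (Fin d) i = toReal (Pi.single i 1) := by
    ext j
    by_cases h : j = i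
    · subst h
      simp [toReal]
    · simp [toReal, h]
  exact h2 ▸ h1 _

theorem repr_nonneg_smul (B : Module.Basis (Fin d) ℝ (Fin d → ℝ)) (c : {c : ℝ // 0 ≤ c})
    (x : Fin d → ℝ) (i : Fin d) : B.repr (c • x) i = c * B.repr x i :=
  DFunLike.congr_fun (B.repr.map_smul (c : ℝ) x) i

theorem exists_basis_of_isSimplicial (hA : intSpan A = ⊤) (h : (cone A).IsSimplicial) :
    ∃ B : Module.Basis (Fin d) ℝ (Fin d → ℝ), ∀ x, x ∈ cone A ↔ ∀ i, 0 ≤ B.repr x i := by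
  obtain ⟨s, hfin, hli, hs⟩ := h
  have hspan : ⊤ ≤ Submodule.span ℝ (Set.range ((↑) : s → Fin d → ℝ)) := by
    rw [← span_cone_eq_top A hA, ← hs, Subtype.range_coe]
    exact Submodule.span_le.2 (PointedCone.hull_le_span ℝ s)
  have : Fintype s := hfin.fintype
  let b := Module.Basis.mk hli hspan
  have hcard : Fintype.card s = d := by
    rw [← Module.finrank_eq_card_basis b, Module.finrank_fin_fun]
  let B := b.reindex (Fintype.equivFinOfCardEq hcard)
  refine ⟨B, fun x => ⟨fun hx i => ?_, fun hx => ?_⟩⟩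
  · rw [← hs] at hx
    induction hx using Submodule.span_induction with
    | mem x hx =>
      obtain ⟨j, hj⟩ : ∃ j, B j = x :=
        ⟨Fintype.equivFinOfCardEq hcard ⟨x, hx⟩, by simp [B, b]⟩
      rw [← hj, Module.Basis.repr_self, Finsupp.single_apply]
      split_ifs <;> norm_num
    | zero => simp
    | add x y _ _ hx hy => simpa using add_nonneg hx hy
    | smul c x _ hx =>
      rw [repr_nonneg_smul]
      exact mul_nonneg c.2 hx
  · rw [← B.sum_repr x]
    refine Submodule.sum_mem _ fun i _ => ?_
    refine PointedCone.smul_mem _ (hx i) ?_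
    rw [← hs]
    refine PointedCone.subset_hull ?_
    simp [B, b]

theorem toReal_mem_cone {a : Fin d → ℤ} (ha : a ∈ natSpan A) : toReal a ∈ cone A := by
  have h : natSpan A ≤ (cone A).toAddSubmonoid.comap (toRealHom d) := by
    rw [natSpan, AddSubmonoid.closure_le]
    rintro _ ⟨j, rfl⟩
    exact PointedCone.subset_hull ⟨j, rfl⟩
  exact h ha

/-- `B i` is a nonnegative combination of columns. Its other coordinates are zero sums of
nonnegative terms, so every column that occurs lies on the `i`-th ray. -/
theorem exists_column_on_ray {B : Module.Basis (Fin d) ℝ (Fin d → ℝ)}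
    (hB : ∀ x, x ∈ cone A ↔ ∀ i, 0 ≤ B.repr x i) (i : Fin d) :
    ∃ j, 0 < B.repr (toReal (A.col j)) i ∧ ∀ k, k ≠ i → B.repr (toReal (A.col j)) k = 0 := by
  have hmem : B i ∈ cone A := by
    rw [hB]
    intro k
    rw [Module.Basis.repr_self, Finsupp.single_apply]
    split_ifs <;> norm_num
  have hcol : ∀ j k, 0 ≤ B.repr (toReal (A.col j)) k := fun j =>
    (hB _).1 (PointedCone.subset_hull ⟨j, rfl⟩)
  obtain ⟨c, hc⟩ := (Submodule.mem_span_range_iff_exists_fun _).1 hmem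
  have hsum : ∀ k, ∑ j, (c j : ℝ) * B.repr (toReal (A.col j)) k = B.repr (B i) k := by
    intro k
    rw [← hc, map_sum, Finsupp.finsetSum_apply]
    exact Finset.sum_congr rfl fun j _ => (repr_nonneg_smul B (c j) _ k).symm
  have hi := hsum i
  rw [Module.Basis.repr_self, Finsupp.single_eq_same] at hi
  obtain ⟨j, -, hj⟩ := Finset.exists_ne_zero_of_sum_ne_zero (hi.trans_ne one_ne_zero)
  refine ⟨j, lt_of_le_of_ne (hcol j i) (right_ne_zero_of_mul hj).symm, fun k hk => ?_⟩
  have h0 := hsum k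
  rw [Module.Basis.repr_self, Finsupp.single_eq_of_ne hk] at h0
  have := (Finset.sum_eq_zero_iff_of_nonneg
    (fun j _ => mul_nonneg (c j).2 (hcol j k))).1 h0 j (Finset.mem_univ j)
  exact (mul_eq_zero.1 this).resolve_left (left_ne_zero_of_mul hj)

theorem exists_integral_basis (hA : intSpan A = ⊤) (h : (cone A).IsSimplicial) :
    ∃ (e : Fin d → Fin n) (B : Module.Basis (Fin d) ℝ (Fin d → ℝ)),
      (∀ i, B i = toReal (A.col (e i))) ∧ ∀ x, x ∈ cone A ↔ ∀ i, 0 ≤ B.repr x i := by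
  obtain ⟨B, hB⟩ := exists_basis_of_isSimplicial A hA h
  choose e he he0 using exists_column_on_ray A hB
  have hu : ∀ i, IsUnit (B.repr (toReal (A.col (e i))) i) := fun i => (he i).ne'.isUnit
  refine ⟨e, B.isUnitSMul hu, fun i => ?_, fun x => ?_⟩
  · rw [Module.Basis.isUnitSMul_apply, ← B.sum_repr (toReal (A.col (e i))), Finset.sum_eq_single i]
    · simp
    · intro k _ hk
      rw [he0 i k hk, zero_smul]
    · simp
  · rw [hB]
    refine forall_congr' fun i => ?_
    rw [Module.Basis.repr_isUnitSMul]
    rw [Units.smul_def, smul_eq_mul, Units.val_inv_eq_inv_val, IsUnit.unit_spec,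
      mul_nonneg_iff_of_pos_left (inv_pos.2 (he i))]

/-- By Cramer's rule the determinant of `u` times the `i`-th coordinate is integral; dividing by a
generator of its image makes it primitive. -/
theorem exists_integral_form {B : Module.Basis (Fin d) ℝ (Fin d → ℝ)} (u : Fin d → Fin d → ℤ)
    (hu : ∀ i, B i = toReal (u i)) (i : Fin d) :
    ∃ (f : (Fin d → ℤ) →+ ℤ) (r : ℝ), 0 < r ∧ (∀ x, (f x : ℝ) = r * B.repr (toReal x) i) ∧
      ∃ x, f x = 1 := by
  let M : Matrix (Fin d) (Fin d) ℤ := Matrix.of u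
  let MR : Matrix (Fin d) (Fin d) ℝ := M.map (Int.castRingHom ℝ)
  let l : (Fin d → ℤ) →+ ℤ :=
    (LinearMap.proj i ∘ₗ Matrix.cramer M.transpose : (Fin d → ℤ) →ₗ[ℤ] ℤ).toAddMonoidHom
  have hlR : ∀ x, (l x : ℝ) = Matrix.cramer MR.transpose (toReal x) i := by
    intro x
    change ((Matrix.cramer M.transpose x i : ℤ) : ℝ) = _
    rw [Matrix.cramer_apply, Matrix.cramer_apply]
    refine ((Int.castRingHom ℝ).map_det _).trans ?_
    congr 1
    ext a b
    by_cases hb : b = i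
    · subst hb
      simp [toReal]
    · simp [hb, MR]
  have hlB : ∀ y, Matrix.cramer MR.transpose y i = MR.det * B.repr y i := by
    intro y
    have h : LinearMap.proj i ∘ₗ Matrix.cramer MR.transpose = MR.det • B.coord i := by
      refine B.ext fun j => ?_
      have hj : B j = MR j := by
        rw [hu]
        rfl
      rw [LinearMap.comp_apply, LinearMap.smul_apply, Module.Basis.coord_apply,
        Module.Basis.repr_self, hj, Matrix.cramer_transpose_row_self]
      by_cases hji : j = i
      · subst hji
        simp
      · simp [Ne.symm hji]
    exact LinearMap.congr_fun h y
  have hdet : MR.det ≠ 0 := by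
    have h : LinearIndependent ℝ MR.row := by
      convert B.linearIndependent using 1
      ext j : 1
      rw [hu]
      rfl
    exact ((Matrix.isUnit_iff_isUnit_det _).1
      (Matrix.linearIndependent_rows_iff_isUnit.1 h)).ne_zero
  obtain ⟨g, hg⟩ : ∃ g : ℤ, l.range = AddSubgroup.zmultiples g := by
    obtain ⟨g, hg⟩ := Int.subgroup_cyclic l.range
    exact ⟨g, by rw [hg, AddSubgroup.zmultiples_eq_closure]⟩
  have hli : (l (u i) : ℝ) = MR.det := by
    rw [hlR, hlB, ← hu, Module.Basis.repr_self, Finsupp.single_eq_same, mul_one]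
  have hdvd : ∀ x, ∃ m : ℤ, l x = m * g := by
    intro x
    have hx : l x ∈ l.range := ⟨x, rfl⟩
    rw [hg] at hx
    obtain ⟨m, hm⟩ := AddSubgroup.mem_zmultiples_iff.1 hx
    exact ⟨m, by rw [← hm, smul_eq_mul]⟩
  have hg0 : g ≠ 0 := by
    rintro rfl
    obtain ⟨m, hm⟩ := hdvd (u i)
    rw [hm] at hli
    simp at hli
    exact hdet hli.symm
  -- The sign of the generator is chosen to make the form nonnegative on the cone.
  obtain ⟨g', hg', hr⟩ : ∃ g' : ℤ, l.range = AddSubgroup.zmultiples g' ∧ 0 < MR.det / g' := by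
    rcases (div_ne_zero hdet (Int.cast_ne_zero.2 hg0 : (g : ℝ) ≠ 0)).lt_or_gt with h | h
    · refine ⟨-g, by rw [hg, AddSubgroup.zmultiples_neg], ?_⟩
      push_cast
      rw [div_neg]
      linarith
    · exact ⟨g, hg, h⟩
  have hg'0 : (g' : ℝ) ≠ 0 := by
    rintro h
    rw [h, div_zero] at hr
    exact lt_irrefl _ hr
  have hdvd' : ∀ x, g' ∣ l x := by
    intro x
    have hx : l x ∈ l.range := ⟨x, rfl⟩
    rwa [hg', Int.mem_zmultiples_iff] at hx
  refine ⟨AddMonoidHom.mk' (fun x => l x / g') fun x y => ?_, MR.det / g', hr, fun x => ?_, ?_⟩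
  · rw [map_add, Int.add_ediv_of_dvd_left (hdvd' x)]
  · rw [AddMonoidHom.mk'_apply, Int.cast_div (hdvd' x) hg'0, hlR, hlB]
    ring
  · obtain ⟨x, hx⟩ : g' ∈ l.range := hg' ▸ AddSubgroup.mem_zmultiples g'
    refine ⟨x, ?_⟩
    rw [AddMonoidHom.mk'_apply, hx, Int.ediv_self (by exact_mod_cast hg'0)]

variable {A}
variable {B : Module.Basis (Fin d) ℝ (Fin d → ℝ)}

/-- The face of the cone on which the `i`-th coordinate vanishes. -/
def coordFace (A : Matrix (Fin d) (Fin n) ℤ) (B : Module.Basis (Fin d) ℝ (Fin d → ℝ)) (i : Fin d) :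
    PointedCone ℝ (Fin d → ℝ) where
  carrier := {x | x ∈ cone A ∧ B.repr x i = 0}
  zero_mem' := ⟨zero_mem _, by simp⟩
  add_mem' := fun ⟨h1, h2⟩ ⟨h3, h4⟩ => ⟨add_mem h1 h3, by simp [h2, h4]⟩
  smul_mem' := fun c x ⟨h1, h2⟩ => ⟨Submodule.smul_mem _ c h1, by
    rw [repr_nonneg_smul, h2, mul_zero]⟩

variable (hB : ∀ x, x ∈ cone A ↔ ∀ i, 0 ≤ B.repr x i)
include hB

theorem basis_mem_cone (i : Fin d) : B i ∈ cone A := by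
  rw [hB]
  intro k
  rw [Module.Basis.repr_self, Finsupp.single_apply]
  split_ifs <;> norm_num

theorem coordFace_isFaceOf (i : Fin d) :
    (coordFace A B i).IsFaceOf (cone A) ∧ coordFace A B i ≠ cone A := by
  refine ⟨⟨fun x hx => hx.1, ?_⟩, fun h => ?_⟩
  · rintro x y a hx hy ha ⟨-, h⟩
    refine ⟨hx, ?_⟩
    rw [map_add, map_smul, Finsupp.add_apply, Finsupp.smul_apply, smul_eq_mul] at h
    have h1 := (hB x).1 hx i
    have h2 := (hB y).1 hy i
    have h3 : a * B.repr x i = 0 := by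
      have := mul_nonneg ha.le h1
      linarith
    exact (mul_eq_zero.1 h3).resolve_left ha.ne'
  · have h1 : B i ∈ coordFace A B i := h ▸ basis_mem_cone hB i
    simpa using h1.2

/-- A larger face has a point with positive `i`-th coordinate; splitting off its `B i` part puts `B
i`, hence every ray, in the face. -/
theorem isFacet_coordFace (i : Fin d) : IsFacet (coordFace A B i) (cone A) := by
  refine ⟨coordFace_isFaceOf hB i, fun τ hτ hle x hx => ⟨hτ.1.le hx, ?_⟩⟩
  by_contra hne
  refine hτ.2 (le_antisymm hτ.1.le fun y hy => ?_)
  have hpos : 0 < B.repr x i := lt_of_le_of_ne ((hB x).1 (hτ.1.le hx) i) (Ne.symm hne)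
  have hi : B i ∈ τ := by
    refine hτ.1.mem_of_smul_add_mem (y := x - B.repr x i • B i) (basis_mem_cone hB i) ?_ hpos
      (by simpa using hx)
    rw [hB]
    intro k
    rw [map_sub, map_smul, Module.Basis.repr_self, Finsupp.sub_apply, Finsupp.smul_apply]
    by_cases hk : k = i
    · subst hk
      simp
    · simpa [Finsupp.single_eq_of_ne hk] using (hB x).1 (hτ.1.le hx) k
  rw [← B.sum_repr y]
  refine Submodule.sum_mem _ fun k _ => PointedCone.smul_mem _ ((hB y).1 hy k) ?_
  by_cases hk : k = i
  · rwa [hk]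
  · exact hle ⟨basis_mem_cone hB k, by simp [Ne.symm hk]⟩

/-- `F` is nonzero, so `F (B i) > 0` for some `i`, which forces `σ` into the `i`-th coordinate face.
By maximality they coincide, so `F` kills the other basis vectors. -/
theorem exists_coord_of_isPrimitiveSupport {σ : PointedCone ℝ (Fin d → ℝ)}
    {F : (Fin d → ℝ) →ₗ[ℝ] ℝ} (hσ : IsFacet σ (cone A)) (hF : IsPrimitiveSupport (cone A) σ F) :
    ∃ i, 0 < F (B i) ∧ ∀ x, F x = F (B i) * B.repr x i := by
  have hFB : ∀ x, F x = ∑ k, B.repr x k * F (B k) := by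
    intro x
    conv_lhs => rw [← B.sum_repr x, map_sum]
    simp only [map_smul, smul_eq_mul]
  obtain ⟨i, hi⟩ : ∃ i, F (B i) ≠ 0 := by
    by_contra h
    push Not at h
    obtain ⟨a, ha⟩ : (1 : ℝ) ∈ Set.range (fun a : Fin d → ℤ => F (toReal a)) := by
      rw [hF.primitive]
      exact ⟨1, by simp⟩
    have ha' : F (toReal a) = 1 := ha
    rw [hFB] at ha'
    simp [h] at ha'
  have hi0 : 0 < F (B i) := lt_of_le_of_ne (hF.nonneg _ (basis_mem_cone hB i)) hi.symm
  refine ⟨i, hi0, fun x => ?_⟩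
  have hle : σ ≤ coordFace A B i := by
    intro x hx
    have hxC := hσ.1.1.le hx
    have h0 := hF.eq_zero x hx
    rw [hFB] at h0
    have := (Finset.sum_eq_zero_iff_of_nonneg fun k _ => mul_nonneg ((hB x).1 hxC k)
      (hF.nonneg _ (basis_mem_cone hB k))).1 h0 i (Finset.mem_univ i)
    exact ⟨hxC, (mul_eq_zero.1 this).resolve_right hi⟩
  have hge := hσ.2 (coordFace_isFaceOf hB i) hle
  rw [hFB, Finset.sum_eq_single i]
  · ring
  · intro k _ hk
    rw [hF.eq_zero (B k) (hge ⟨basis_mem_cone hB k, by simp [hk]⟩), mul_zero]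
  · simp

end SimplicialCone

/-! ### Translation to the matrix statement. -/

section Main

variable {d n : ℕ} (A : Matrix (Fin d) (Fin n) ℤ)

theorem exists_sub_of_intSpan (hA : intSpan A = ⊤) (x : Fin d → ℤ) :
    ∃ s ∈ natSpan A, ∃ t ∈ natSpan A, x = s - t := by
  have hx : x ∈ intSpan A := hA ▸ AddSubgroup.mem_top x
  induction hx using AddSubgroup.closure_induction with
  | mem x hx => exact ⟨x, AddSubmonoid.subset_closure hx, 0, zero_mem _, by simp⟩
  | zero => exact ⟨0, zero_mem _, 0, zero_mem _, by simp⟩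
  | add x y _ _ hx hy =>
    obtain ⟨s, hs, t, ht, rfl⟩ := hx
    obtain ⟨s', hs', t', ht', rfl⟩ := hy
    exact ⟨s + s', add_mem hs hs', t + t', add_mem ht ht', by abel⟩
  | neg x _ hx =>
    obtain ⟨s, hs, t, ht, rfl⟩ := hx
    exact ⟨t, ht, s, hs, by abel⟩

theorem exists_finite_generators_natSpan :
    ∃ T : Set (natSpan A), AddSubmonoid.closure T = ⊤ ∧ T.Finite :=
  ⟨_, AddSubmonoid.closure_closure_coe_preimage,
    (Set.finite_range _).preimage Subtype.val_injective.injOn⟩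

theorem exists_simplicialForms (hA : intSpan A = ⊤) (h : (cone A).IsSimplicial) :
    ∃ D : SimplicialForms (natSpan A) d, D.Scored ↔ IsScored A := by
  obtain ⟨e, B, hBe, hB⟩ := exists_integral_basis A hA h
  choose f r hr hf hf1 using exists_integral_form (fun i => A.col (e i)) hBe
  have hfB : ∀ i j, (f i (A.col (e j)) : ℝ) = r i * B.repr (B j) i := fun i j => by rw [hf, hBe]
  let D : SimplicialForms (natSpan A) d :=
    { form := f
      ray := fun i => A.col (e i)
      ray_mem := fun i => AddSubmonoid.subset_closure ⟨e i, rfl⟩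
      form_ray_of_ne := fun i j hij => by
        have := hfB i j
        rw [Module.Basis.repr_self, Finsupp.single_eq_of_ne hij, mul_zero] at this
        exact_mod_cast this
      form_ray_pos := fun i => by
        have := hfB i i
        rw [Module.Basis.repr_self, Finsupp.single_eq_same, mul_one] at this
        exact_mod_cast this ▸ hr i
      nonneg := fun i x hx => by
        have := mul_nonneg (hr i).le ((hB _).1 (toReal_mem_cone A hx) i)
        rw [← hf] at this
        exact_mod_cast this
      exists_form_eq_one := hf1
      eq_zero_of_form := fun x hx => by
        have h0 : toReal x = 0 := by
          refine B.repr.map_eq_zero_iff.1 (Finsupp.ext fun i => ?_)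
          have := hf i x
          rw [hx, Int.cast_zero, eq_comm] at this
          exact (mul_eq_zero.1 this).resolve_left (hr i).ne'
        exact toReal_injective (h0.trans (toRealHom d).map_zero.symm)
      exists_sub := exists_sub_of_intSpan A hA }
  refine ⟨D, fun hD => ?_, fun hA a ha => ?_⟩
  · refine Set.Subset.antisymm (fun a ha σ F _ _ => ⟨a, ha, rfl⟩) fun a ha => hD a fun i => ?_
    have hFi : ∀ x, (r i • B.coord i) (toReal x) = f i x := fun x => (hf i x).symm
    obtain ⟨b, hb, hba⟩ := ha (coordFace A B i) (r i • B.coord i) (isFacet_coordFace hB i)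
      { nonneg := fun x hx => mul_nonneg (hr i).le ((hB x).1 hx i)
        eq_zero := fun x hx => by
          have h0 : B.repr x i = 0 := hx.2
          simp [h0]
        primitive := by
          simp only [hFi]
          refine Set.Subset.antisymm ?_ ?_
          · rintro _ ⟨x, rfl⟩
            exact ⟨_, rfl⟩
          · rintro _ ⟨m, rfl⟩
            obtain ⟨x, hx⟩ := hf1 i
            exact ⟨m • x, congrArg _ (by rw [map_zsmul, hx, smul_eq_mul, mul_one])⟩ }
    simp only [hFi] at hba
    exact ⟨b, hb, by exact_mod_cast hba⟩
  · have hmem : a ∈ {a | ∀ (σ : PointedCone ℝ (Fin d → ℝ)) (F : (Fin d → ℝ) →ₗ[ℝ] ℝ),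
        IsFacet σ (cone A) → IsPrimitiveSupport (cone A) σ F →
        F (toReal a) ∈ (fun b => F (toReal b)) '' (natSpan A : Set (Fin d → ℤ))} := by
      intro σ F hσ hF
      -- `F` and `f i` are both multiples of the `i`-th coordinate, so equal values of `f i` give
      -- equal values of `F`; `F = f i` need not be shown.
      obtain ⟨i, hi, hFi⟩ := exists_coord_of_isPrimitiveSupport hB hσ hF
      obtain ⟨b, hb, hba⟩ := ha i
      refine ⟨b, hb, ?_⟩
      have h1 : (f i b : ℝ) = f i a := by exact_mod_cast hba
      rw [hf, hf] at h1
      change F (toReal b) = F (toReal a)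
      rw [hFi (toReal b), hFi (toReal a), mul_left_cancel₀ (hr i).ne' h1]
    have := (Set.ext_iff.1 hA a).2 hmem
    exact this

end Main

end ToricDiffOp

end

theorem mainTheorem8 (d n : ℕ) (A : Matrix (Fin d) (Fin n) ℤ)
    (hA : ToricDiffOp.intSpan A = ⊤)
    (hsimplicial : (ToricDiffOp.cone A).IsSimplicial) :
    IsSimpleRing (ToricDiffOp.ringDiffOp A) ↔ ToricDiffOp.IsScored A := by
  obtain ⟨D, hD⟩ := ToricDiffOp.exists_simplicialForms A hA hsimplicial
  rw [← hD]
  exact ⟨D.scored_of_isSimpleRing (ToricDiffOp.exists_finite_generators_natSpan A),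
    D.isSimpleRing_of_scored⟩
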